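/- A graph database $G=(N_G,E_G,\eta_G,\lambda_G)$ consists of finite sets $N_G$ of nodes and $E_G$ of edges, an incidence mapping $\eta_G:E_G\to N_G\times N_G$ and a labeling $\lambda_G:E_G\to\mathcal L$. A path is a sequence $v_0e_1v_1\cdots e_nv_n$ ($n\ge 0$) with $\eta_G(e_i)=(v_{i-1},v_i)$ for all $i$. A path multiset representation (PMR) over $G$ is a finite directed multigraph $R$ with a graph homomorphism $\gamma$ from $R$ to $G$ (the labels of $G$ being ignored) and sets $S,T$ of source and target nodes of $R$; it represents the set of paths $\mathrm{SPaths}(R)=\{\gamma(\rho)\mid \rho\text{ is a path from } S \text{ to } T\text{ in }R\}$. An NFA $\mathcal A=(Q,\Sigma,\Delta,I,F)$, with finite $Q$, finite $\Sigma\subseteq\mathcal L$, $\Delta\subseteq Q\times\Sigma\times Q$ and $I,F\subseteq Q$, is unambiguous (a UFA) if every word has at most one accepting run. The product $G\times \mathcal A$ is the PMR over $G$ with nodes $N_G\times Q$; edges $(e,(q_1,a,q_2))\in E_G\times\Delta$ with $a=\lambda_G(e)$, which lead from $(v_1,q_1)$ to $(v_2,q_2)$ if $\eta_G(e)=(v_1,v_2)$;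 $\gamma(v,q)=v$ and $\gamma(e,d)=e$; $S=N_G\times I$ and $T=N_G\times F$. Finally, $\mathrm{trim}(G\times\mathcal A)$ is obtained from $G\times \mathcal A$ by removing all nodes and edges that do not participate in a path from $S$ to $T$. **Proposition.** Let $G$ be a graph database, let $\mathcal A_1,\mathcal A_2$ be UFAs, and let $R_i=\mathrm{trim}(G\times\mathcal A_i)$ for $i=1,2$. Then one can test in polynomial time whether $\mathrm{SPaths}(R_1)=\mathrm{SPaths}(R_2)$. Precisely: there is a single algorithm that, for all such $G,\mathcal A_1,\mathcal A_2$, decides this on input $(R_1,R_2)$ in time polynomial in the size of $R_1$ and $R_2$; and there is likewise a single algorithm that decides it on input $(G,\mathcal A_1,\mathcal A_2)$ in time polynomial in the size of $G,\mathcal A_1,\mathcal A_2$. The model of computation is a random access machine on natural numbers, with identifiers and numbers occupying one cell each and with memory access, addition, truncated subtraction and tests for zero at unit cost (no multiplication). -/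

import Mathlib

/-! ## Random access machines

Programs of a random access machine with structured control flow. A state consists of registers
and an array of memory cells, all holding natural numbers. The arithmetic operations are addition
and truncated subtraction only (no multiplication), so that unit cost is a realistic measure:
in `t` steps the bit length of the numbers grows by `O(t)` only. -/

namespace RAM

/-- States: the contents of the registers and of the (indirectly addressable) memory cells. -/
structure State where
  reg : ℕ → ℕ
  mem : ℕ → ℕ

/-- Expressions; `cell e` is the content of the memory cell whose address is the value of `e`. -/
inductive Expr where
  | const (n : ℕ)
  | reg (r : ℕ)
  | cell (e : Expr)
  | add (e f : Expr)
  | sub (e f : Expr)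

/-- The value of an expression in a state. -/
def Expr.eval (s : State) : Expr → ℕ
  | .const n => n
  | .reg r => s.reg r
  | .cell e => s.mem (e.eval s)
  | .add e f => e.eval s + f.eval s
  | .sub e f => e.eval s - f.eval s

/-- The number of elementary operations needed to evaluate an expression. -/
def Expr.cost : Expr → ℕ
  | .const _ => 1
  | .reg _ => 1
  | .cell e => e.cost + 1
  | .add e f => e.cost + f.cost + 1
  | .sub e f => e.cost + f.cost + 1

/-- Programs. `assign r e` puts the value of `e` into register `r`, and `store e f` puts the value
of `f` into the memory cell whose address is the value of `e`. Conditions hold when nonzero. -/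
inductive Prog where
  | assign (r : ℕ) (e : Expr)
  | store (e f : Expr)
  | seq (c d : Prog)
  | ite (e : Expr) (c d : Prog)
  | loop (e : Expr) (c : Prog)

/-- `Exec c s t s'`: started in state `s`, the program `c` halts in state `s'` after exactly `t`
elementary operations. -/
inductive Exec : Prog → State → ℕ → State → Prop where
  | assign (r : ℕ) (e : Expr) (s : State) :
      Exec (.assign r e) s (e.cost + 1) { s with reg := Function.update s.reg r (e.eval s) }
  | store (e f : Expr) (s : State) :
      Exec (.store e f) s (e.cost + f.cost + 1)
        { s with mem := Function.update s.mem (e.eval s) (f.eval s) }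
  | seq {c d : Prog} {s s' s'' : State} {t t' : ℕ} :
      Exec c s t s' → Exec d s' t' s'' → Exec (.seq c d) s (t + t') s''
  | ite_true {e : Expr} {c : Prog} (d : Prog) {s s' : State} {t : ℕ} :
      e.eval s ≠ 0 → Exec c s t s' → Exec (.ite e c d) s (e.cost + 1 + t) s'
  | ite_false {e : Expr} (c : Prog) {d : Prog} {s s' : State} {t : ℕ} :
      e.eval s = 0 → Exec d s t s' → Exec (.ite e c d) s (e.cost + 1 + t) s'
  | loop_done {e : Expr} (c : Prog) {s : State} :
      e.eval s = 0 → Exec (.loop e c) s (e.cost + 1) s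
  | loop_step {e : Expr} {c : Prog} {s s' s'' : State} {t t' : ℕ} :
      e.eval s ≠ 0 → Exec c s t s' → Exec (.loop e c) s' t' s'' →
        Exec (.loop e c) s (e.cost + 1 + t + t') s''

/-- The machine is deterministic. -/
theorem Exec.deterministic {c : Prog} {s s₁ s₂ : State} {t₁ t₂ : ℕ}
    (h₁ : Exec c s t₁ s₁) (h₂ : Exec c s t₂ s₂) : t₁ = t₂ ∧ s₁ = s₂ := by
  induction h₁ generalizing t₂ s₂ with
  | assign r e s => cases h₂; exact ⟨rfl, rfl⟩
  | store e f s => cases h₂; exact ⟨rfl, rfl⟩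
  | seq _ _ ih ih' =>
    cases h₂ with
    | seq g g' =>
      obtain ⟨rfl, rfl⟩ := ih g
      obtain ⟨rfl, rfl⟩ := ih' g'
      exact ⟨rfl, rfl⟩
  | ite_true d he _ ih =>
    cases h₂ with
    | ite_true _ _ g => obtain ⟨rfl, rfl⟩ := ih g; exact ⟨rfl, rfl⟩
    | ite_false _ g' _ => exact absurd g' he
  | ite_false c he _ ih =>
    cases h₂ with
    | ite_true _ g' _ => exact absurd he g'
    | ite_false _ _ g => obtain ⟨rfl, rfl⟩ := ih g; exact ⟨rfl, rfl⟩
  | loop_done c he =>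
    cases h₂ with
    | loop_done => exact ⟨rfl, rfl⟩
    | loop_step g _ _ => exact absurd he g
  | loop_step he _ _ ih ih' =>
    cases h₂ with
    | loop_done _ g => exact absurd g he
    | loop_step _ g g' =>
      obtain ⟨rfl, rfl⟩ := ih g
      obtain ⟨rfl, rfl⟩ := ih' g'
      exact ⟨rfl, rfl⟩

/-- The initial state on an input word: the input occupies the first memory cells, register `0`
holds its length, and everything else is zero. -/
def initial (w : List ℕ) : State where
  reg := Function.update (fun _ => 0) 0 w.length
  mem := fun i => w.getD i 0

/-- On input `w`, the program halts after at most `t` elementary operations, and register `0`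
then holds `1` if `P` is true and `0` if `P` is false. -/
def Prog.TestsWithin (c : Prog) (w : List ℕ) (P : Prop) (t : ℕ) : Prop :=
  ∃ (k : ℕ) (s : State), Exec c (initial w) k s ∧ k ≤ t ∧
    (P → s.reg 0 = 1) ∧ (¬ P → s.reg 0 = 0)

end RAM

/-! ## Unambiguous automata -/

/-- The accepting runs of an NFA on a word. -/
structure NFA.AcceptingRun {L Q : Type*} (A : NFA L Q) (w : List L) where
  first : Q
  last : Q
  first_mem : first ∈ A.start
  last_mem : last ∈ A.accept
  run : A.Path first last w

/-- An NFA is unambiguous if it has at most one accepting run on every word. -/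
def NFA.Unambiguous {L Q : Type*} (A : NFA L Q) : Prop :=
  ∀ w : List L, Subsingleton (A.AcceptingRun w)

/-- The transitions `(q₁, a, q₂)` of an NFA. -/
def NFA.Transition {L Q : Type*} (A : NFA L Q) : Type _ :=
  {d : Q × L × Q // d.2.2 ∈ A.step d.1 d.2.1}

/-! ## Graphs, graph databases and paths -/

/-- Unlabeled directed multigraphs with nodes `N`, edges `E` and incidence mapping `η`. -/
structure UGraph (N E : Type*) where
  η : E → N × N

/-- Graph databases: directed multigraphs whose edges carry labels. -/
structure GraphDB (N E L : Type*) extends UGraph N E where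
  lab : E → L

/-- Alternating sequences `v₀ e₁ v₁ … eₙ vₙ`, stored as `v₀` and `[(e₁, v₁), …, (eₙ, vₙ)]`. -/
structure PathSeq (N E : Type*) where
  src : N
  steps : List (E × N)

namespace PathSeq

variable {N E N' E' : Type*}

/-- The nodes `v₀, …, vₙ` of the sequence. -/
def nodes (ρ : PathSeq N E) : List N := ρ.src :: ρ.steps.map Prod.snd

/-- The edges `e₁, …, eₙ` of the sequence. -/
def edges (ρ : PathSeq N E) : List E := ρ.steps.map Prod.fst

/-- The last node `vₙ` of the sequence. -/
def tgt (ρ : PathSeq N E) : N := ρ.nodes.getLast (List.cons_ne_nil _ _)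

/-- The image of the sequence under a map of nodes and a map of edges. -/
def map (f : N → N') (g : E → E') (ρ : PathSeq N E) : PathSeq N' E' where
  src := f ρ.src
  steps := ρ.steps.map (Prod.map g f)

end PathSeq

/-- `[(e₁, v₁), …, (eₙ, vₙ)]` continues a path that has arrived in `v₀`: each `eᵢ` goes from
`vᵢ₋₁` to `vᵢ`. -/
def UGraph.IsWalkFrom {N E : Type*} (H : UGraph N E) : N → List (E × N) → Prop
  | _, [] => True
  | v, (e, u) :: l => H.η e = (v, u) ∧ H.IsWalkFrom u l

/-- The sequence is a path of the graph. -/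
def UGraph.IsPath {N E : Type*} (H : UGraph N E) (ρ : PathSeq N E) : Prop :=
  H.IsWalkFrom ρ.src ρ.steps

/-! ## Path multiset representations -/

/-- Path multiset representations over the graph database `G`, with nodes `V` and edges `W`. -/
structure PMR {N E L : Type*} (G : GraphDB N E L) (V W : Type*) extends UGraph V W where
  γN : V → N
  γE : W → E
  hom : ∀ e, G.η (γE e) = (γN (η e).1, γN (η e).2)
  S : Set V
  T : Set V

namespace PMR

variable {N E L V W : Type*} {G : GraphDB N E L}

/-- The paths of `R` from `S` to `T`. -/
def IsSTPath (R : PMR G V W) (ρ : PathSeq V W) : Prop :=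
  R.IsPath ρ ∧ ρ.src ∈ R.S ∧ ρ.tgt ∈ R.T

/-- The set of paths represented by `R`. -/
def spaths (R : PMR G V W) : Set (PathSeq N E) :=
  {π | ∃ ρ, R.IsSTPath ρ ∧ ρ.map R.γN R.γE = π}

/-- The nodes that participate in a path from `S` to `T`. -/
def UsefulNode (R : PMR G V W) (v : V) : Prop := ∃ ρ, R.IsSTPath ρ ∧ v ∈ ρ.nodes

/-- The edges that participate in a path from `S` to `T`. -/
def UsefulEdge (R : PMR G V W) (e : W) : Prop := ∃ ρ, R.IsSTPath ρ ∧ e ∈ ρ.edges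

theorem endpoints_mem_of_isWalkFrom {V W : Type*} (H : UGraph V W) {e : W} :
    ∀ (l : List (W × V)) (v : V), H.IsWalkFrom v l → e ∈ l.map Prod.fst →
      (H.η e).1 ∈ v :: l.map Prod.snd ∧ (H.η e).2 ∈ v :: l.map Prod.snd
  | [], _, _, h => by simp at h
  | (e', u) :: l, v, ⟨h, hl⟩, he => by
    simp only [List.map_cons, List.mem_cons] at he
    rcases he with rfl | he
    · simp [h]
    · have := endpoints_mem_of_isWalkFrom H l u hl he
      exact ⟨List.mem_cons_of_mem _ this.1, List.mem_cons_of_mem _ this.2⟩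

theorem UsefulEdge.usefulNode {R : PMR G V W} {e : W} (h : R.UsefulEdge e) :
    R.UsefulNode (R.η e).1 ∧ R.UsefulNode (R.η e).2 := by
  obtain ⟨ρ, hρ, he⟩ := h
  have := endpoints_mem_of_isWalkFrom R.toUGraph ρ.steps ρ.src hρ.1 he
  exact ⟨⟨ρ, hρ, this.1⟩, ⟨ρ, hρ, this.2⟩⟩

/-- The subgraph of `R` that is obtained by removing all nodes and edges that do not participate
in a path from `S` to `T`. -/
def trim (R : PMR G V W) : PMR G {v // R.UsefulNode v} {e // R.UsefulEdge e} where
  η e := (⟨(R.η e.1).1, e.2.usefulNode.1⟩, ⟨(R.η e.1).2, e.2.usefulNode.2⟩)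
  γN v := R.γN v.1
  γE e := R.γE e.1
  hom e := R.hom e.1
  S := {v | v.1 ∈ R.S}
  T := {v | v.1 ∈ R.T}

end PMR

/-- The product of a graph database and an automaton. -/
def GraphDB.prod {N E L Q : Type*} (G : GraphDB N E L) (A : NFA L Q) :
    PMR G (N × Q) {p : E × A.Transition // p.2.1.2.1 = G.lab p.1} where
  η p := (((G.η p.1.1).1, p.1.2.1.1), ((G.η p.1.1).2, p.1.2.1.2.2))
  γN v := v.1
  γE p := p.1.1
  hom _ := rfl
  S := {v | v.2 ∈ A.start}
  T := {v | v.2 ∈ A.accept}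

/-! ## Encoding finite objects as machine input

Nodes, edges, states and transitions are listed in an arbitrary order, and nodes and states are
referred to by their positions in the list. -/

noncomputable section

open Classical in
/-- `1` for true and `0` for false. -/
def bitOf (P : Prop) : ℕ := if P then 1 else 0

/-- Input format for PMRs, where `ν` and `ε` are the identifiers of the nodes and edges of `G`:
the number of nodes; the number of edges; for each node `v` the identifier of `γ(v)` and two bits
for `v ∈ S` and `v ∈ T`; for each edge `e` the identifier of `γ(e)` and the positions of its two
endpoints. -/
def PMR.encode {N E L V W : Type*} {G : GraphDB N E L} (R : PMR G V W) (ν : N ↪ ℕ) (ε : E ↪ ℕ)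
    {n m : ℕ} (v : Fin n ≃ V) (e : Fin m ≃ W) : List ℕ :=
  n :: m ::
    ((List.ofFn fun i => [ν (R.γN (v i)), bitOf (v i ∈ R.S), bitOf (v i ∈ R.T)]).flatten ++
     (List.ofFn fun j => [ε (R.γE (e j)), (v.symm (R.η (e j)).1 : ℕ),
        (v.symm (R.η (e j)).2 : ℕ)]).flatten)

/-- Input format for graph databases, where `ν`, `ε` and `ℓ` give the identifiers of nodes, edges
and labels: the number of nodes; the number of edges; for each node its identifier; for each edge
its identifier, the positions of its two endpoints and its label. -/
def GraphDB.encode {N E L : Type*} (G : GraphDB N E L) (ν : N ↪ ℕ) (ε : E ↪ ℕ) (ℓ : L ↪ ℕ)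
    {n m : ℕ} (v : Fin n ≃ N) (e : Fin m ≃ E) : List ℕ :=
  n :: m ::
    ((List.ofFn fun i => ν (v i)) ++
     (List.ofFn fun j => [ε (e j), (v.symm (G.η (e j)).1 : ℕ), (v.symm (G.η (e j)).2 : ℕ),
        ℓ (G.lab (e j))]).flatten)

/-- Input format for automata, where `ℓ` gives the identifiers of the labels: the number of states;
the number of transitions; for each state two bits for being initial and being final; for each
transition `(q₁, a, q₂)` the position of `q₁`, the label `a` and the position of `q₂`. -/
def NFA.encode {L Q : Type*} (A : NFA L Q) (ℓ : L ↪ ℕ) {n m : ℕ} (q : Fin n ≃ Q)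
    (d : Fin m ≃ A.Transition) : List ℕ :=
  n :: m ::
    ((List.ofFn fun i => [bitOf (q i ∈ A.start), bitOf (q i ∈ A.accept)]).flatten ++
     (List.ofFn fun j => [(q.symm (d j).1.1 : ℕ), ℓ (d j).1.2.1,
        (q.symm (d j).1.2.2 : ℕ)]).flatten)

end

/-! ## Terms and their compilation -/

/-! Unambiguity turns an equality of sets into equalities of numbers. A path of `G` is determined by
its first node and its edges, and a path of `G.prod A` over it is determined by the run of `A` that
it carries. For a UFA every path of `G` therefore has at most one preimage from `S` to `T`
(`GraphDB.unambiguous_prod`), and trimming preserves this. So the represented sets agree if and only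
if, for every node identifier `a` and every word `l` of edge identifiers, the signed count `c(a, l)`
vanishes: the number of paths from `S` to `T` with this start and this word in the first PMR, minus
the number in the second (`PMR.spaths_eq_iff`).

These conditions are infinite in number, but squaring collapses them. In the disjoint union of the
two PMRs, the sum of `c(a, l) ^ 2` over all `a` and all `l` of length `k` is the number of pairs of
walks with equal start identifier and equal word that start on the same side, minus the number of
such pairs on opposite sides (`Net.form_pairs`, `Net.form_pairs_eq_sum_sq`). The difference is
nonnegative, and all signed counts of length `k` vanish if and only if it is at most zero. The
numbers of pairs from `(v, v')` evolve with `k` by a fixed linear map on `V × V → ℤ`, so by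
Cayley–Hamilton a linear functional of them vanishes for all `k` once it does for `k < |V| ^ 2`
(`Module.End.apply_pow_eq_zero_of_lt_finrank`, `Net.same_le_opposite_iff`).

The machine tabulates these numbers by dynamic programming, which needs additions only. Let `l` be
the input length. Nodes and edges are coded by pairs of numbers below `l`, so `|V| ≤ l ^ 2` and the
lengths `k < l ^ 4` suffice; a table entry has eight digits in base `l`, four for `k` and two for
each node. The computation is written in a language of terms with sums over the numbers below `l`,
whose compilation is proved correct and polynomial once (`Term.computes`, `execWithin_fill`). The
two input formats differ only in the `Access` terms that read the net off the input; for the second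
format the products are neither constructed nor trimmed. -/

namespace RAM

open Polynomial

/-- Started in state `s`, the program `c` halts in state `s'` after at most `b` operations. -/
def ExecWithin (c : Prog) (s : State) (b : ℕ) (s' : State) : Prop := ∃ k ≤ b, Exec c s k s'

namespace ExecWithin

variable {c d : Prog} {s s' s'' : State} {b b' : ℕ}

theorem mono (h : ExecWithin c s b s') (hb : b ≤ b') : ExecWithin c s b' s' :=
  let ⟨k, hk, h⟩ := h; ⟨k, hk.trans hb, h⟩

theorem seq (h : ExecWithin c s b s') (h' : ExecWithin d s' b' s'') :
    ExecWithin (.seq c d) s (b + b') s'' :=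
  let ⟨_, hk, h⟩ := h; let ⟨_, hk', h'⟩ := h'; ⟨_, add_le_add hk hk', .seq h h'⟩

theorem assign (r : ℕ) (e : Expr) (s : State) : ExecWithin (.assign r e) s (e.cost + 1)
    { s with reg := Function.update s.reg r (e.eval s) } := ⟨_, le_rfl, .assign r e s⟩

theorem store (e f : Expr) (s : State) : ExecWithin (.store e f) s (e.cost + f.cost + 1)
    { s with mem := Function.update s.mem (e.eval s) (f.eval s) } := ⟨_, le_rfl, .store e f s⟩

theorem ite_true {e : Expr} (d : Prog) (he : e.eval s ≠ 0) (h : ExecWithin c s b s') :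
    ExecWithin (.ite e c d) s (e.cost + 1 + b) s' :=
  let ⟨_, hk, h⟩ := h; ⟨_, by gcongr, .ite_true d he h⟩

theorem ite_false {e : Expr} (c : Prog) (he : e.eval s = 0) (h : ExecWithin d s b s') :
    ExecWithin (.ite e c d) s (e.cost + 1 + b) s' :=
  let ⟨_, hk, h⟩ := h; ⟨_, by gcongr, .ite_false c he h⟩

theorem loop_done {e : Expr} (c : Prog) (he : e.eval s = 0) :
    ExecWithin (.loop e c) s (e.cost + 1) s := ⟨_, le_rfl, .loop_done c he⟩

theorem loop_step {e : Expr} (he : e.eval s ≠ 0) (h : ExecWithin c s b s')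
    (h' : ExecWithin (.loop e c) s' b' s'') :
    ExecWithin (.loop e c) s (e.cost + 1 + b + b') s'' :=
  let ⟨_, hk, h⟩ := h; let ⟨_, hk', h'⟩ := h'; ⟨_, by gcongr, .loop_step he h h'⟩

/-- `Term.Computes.binary` runs two operands as one block, whereas `Term.compile` nests sequences to
the right. -/
theorem assoc {e : Prog}
    (h : ExecWithin (.seq (.seq c d) e) s b s') : ExecWithin (.seq c (.seq d e)) s b s' := by
  obtain ⟨k, hk, h⟩ := h
  cases h with
  | seq h h₃ =>
    cases h with
    | seq h₁ h₂ => exact ⟨_, by rwa [← add_assoc], .seq h₁ (.seq h₂ h₃)⟩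

end ExecWithin

/-- Arithmetic terms in which every summation variable ranges over the numbers below a fixed bound
`len`. `ite c t e` is `t` if `c` is nonzero, and `e` otherwise. -/
inductive Term where
  | const (n : ℕ)
  | len
  | var (i : ℕ)
  | cell (t : Term)
  | add (t u : Term)
  | sub (t u : Term)
  | sum (v : ℕ) (t : Term)
  | ite (c t e : Term)

namespace Term

/-- The value of a term, for the bound `l`, the memory `M` and the values `ρ` of the variables. -/
def eval (l : ℕ) (M : ℕ → ℕ) : (ℕ → ℕ) → Term → ℕ
  | _, const n => n
  | _, len => l
  | ρ, var i => ρ i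
  | ρ, cell t => M (t.eval l M ρ)
  | ρ, add t u => t.eval l M ρ + u.eval l M ρ
  | ρ, sub t u => t.eval l M ρ - u.eval l M ρ
  | ρ, sum v t => ∑ j ∈ Finset.range l, t.eval l M (Function.update ρ v j)
  | ρ, ite c t e => if c.eval l M ρ ≠ 0 then t.eval l M ρ else e.eval l M ρ

/-- A program that puts the value of a term into register `2 * d + 1`. Register `2` holds the
bound `len`, and register `2 * i + 4` holds the variable `i`. -/
def compile : ℕ → Term → Prog
  | d, const n => .assign (2 * d + 1) (.const n)
  | d, len => .assign (2 * d + 1) (.reg 2)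
  | d, var i => .assign (2 * d + 1) (.reg (2 * i + 4))
  | d, cell t => .seq (t.compile d) (.assign (2 * d + 1) (.cell (.reg (2 * d + 1))))
  | d, add t u => .seq (t.compile d) (.seq (u.compile (d + 1))
      (.assign (2 * d + 1) (.add (.reg (2 * d + 1)) (.reg (2 * (d + 1) + 1)))))
  | d, sub t u => .seq (t.compile d) (.seq (u.compile (d + 1))
      (.assign (2 * d + 1) (.sub (.reg (2 * d + 1)) (.reg (2 * (d + 1) + 1)))))
  | d, sum v t =>
      .seq (.assign (2 * d + 1) (.const 0)) <|
      .seq (.assign (2 * (d + 1) + 1) (.reg (2 * v + 4))) <|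
      .seq (.assign (2 * v + 4) (.reg 2)) <|
      .seq (.loop (.reg (2 * v + 4)) <|
        .seq (.assign (2 * v + 4) (.sub (.reg (2 * v + 4)) (.const 1))) <|
        .seq (t.compile (d + 2)) <|
        .assign (2 * d + 1) (.add (.reg (2 * d + 1)) (.reg (2 * (d + 2) + 1))))
      (.assign (2 * v + 4) (.reg (2 * (d + 1) + 1)))
  | d, ite c t e => .seq (c.compile d) (.ite (.reg (2 * d + 1)) (t.compile d) (e.compile d))

/-- A bound on the number of operations of `compile`, as a polynomial in `len`. -/
noncomputable def cost : Term → ℕ[X]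
  | const _ => 2
  | len => 2
  | var _ => 2
  | cell t => t.cost + 3
  | add t u => t.cost + u.cost + 4
  | sub t u => t.cost + u.cost + 4
  | sum _ t => X * (t.cost + 10) + 10
  | ite c t e => c.cost + t.cost + e.cost + 2

/-- The state `s'` differs from `s` only in the odd registers with index at least `2 * d + 1`. -/
structure Preserves (d : ℕ) (s s' : State) : Prop where
  mem : s'.mem = s.mem
  even : ∀ i, s'.reg (2 * i) = s.reg (2 * i)
  odd : ∀ i < d, s'.reg (2 * i + 1) = s.reg (2 * i + 1)

/-- The values of the variables in a state. -/
def env (s : State) (i : ℕ) : ℕ := s.reg (2 * i + 4)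

theorem Preserves.env_eq {d : ℕ} {s s' : State} (h : Preserves d s s') : env s' = env s :=
  funext fun i => h.even (i + 2)

theorem Preserves.reg_two {d : ℕ} {s s' : State} (h : Preserves d s s') : s'.reg 2 = s.reg 2 :=
  h.even 1

theorem Preserves.trans {d : ℕ} {s s' s'' : State} (h : Preserves d s s') (h' : Preserves d s' s'') :
    Preserves d s s'' :=
  ⟨h'.mem.trans h.mem, fun i => (h'.even i).trans (h.even i),
    fun i hi => (h'.odd i hi).trans (h.odd i hi)⟩

theorem Preserves.mono {d d' : ℕ} {s s' : State} (h : Preserves d' s s') (hd : d ≤ d') :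
    Preserves d s s' :=
  ⟨h.mem, h.even, fun i hi => h.odd i (hi.trans_le hd)⟩

theorem Preserves.update (d : ℕ) (s : State) (x : ℕ) :
    Preserves d s { s with reg := Function.update s.reg (2 * d + 1) x } :=
  ⟨rfl, fun _ => Function.update_of_ne (by omega) _ _,
    fun _ _ => Function.update_of_ne (by omega) _ _⟩

/-- The specification of `compile`. -/
def Computes (t : Term) : Prop :=
  ∀ (d : ℕ) (s : State), ∃ s', ExecWithin (t.compile d) s (t.cost.eval (s.reg 2)) s' ∧
    Preserves d s s' ∧ s'.reg (2 * d + 1) = t.eval (s.reg 2) s.mem (env s)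

/-- The second operand is compiled at depth `d + 1`, so the first value survives in register `2 * d
+ 1`, and the second operand still sees the memory and the variables of `s`. -/
theorem Computes.binary {t u : Term} (ht : t.Computes) (hu : u.Computes) (d : ℕ) (s : State) :
    ∃ s', ExecWithin (.seq (t.compile d) (u.compile (d + 1))) s
        (t.cost.eval (s.reg 2) + u.cost.eval (s.reg 2)) s' ∧ Preserves d s s' ∧
      s'.reg (2 * d + 1) = t.eval (s.reg 2) s.mem (env s) ∧
      s'.reg (2 * (d + 1) + 1) = u.eval (s.reg 2) s.mem (env s) := by
  obtain ⟨s₁, h₁, p₁, e₁⟩ := ht d s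
  obtain ⟨s₂, h₂, p₂, e₂⟩ := hu (d + 1) s₁
  rw [p₁.reg_two] at h₂
  refine ⟨s₂, h₁.seq h₂, p₁.trans (p₂.mono d.le_succ), ?_, ?_⟩
  · rw [p₂.odd d d.lt_succ_self, e₁]
  · rw [e₂, p₁.reg_two, p₁.mem, p₁.env_eq]

/-- Induction on the counter. It is decremented before the body runs, so the body sees `n - 1, …,
0`. The body works at depth `d + 2`: it spares the accumulator `2 * d + 1` and also register `2 * (d
+ 1) + 1`, in which `computes_sum` keeps the old value of `v`. -/
theorem computes_loop {t : Term} (ht : t.Computes) (v d n : ℕ) : ∀ s : State,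
    s.reg (2 * v + 4) = n →
    ∃ s', ExecWithin (.loop (.reg (2 * v + 4)) <|
        .seq (.assign (2 * v + 4) (.sub (.reg (2 * v + 4)) (.const 1))) <|
        .seq (t.compile (d + 2)) <|
        .assign (2 * d + 1) (.add (.reg (2 * d + 1)) (.reg (2 * (d + 2) + 1)))) s
        (n * (t.cost.eval (s.reg 2) + 10) + 2) s' ∧
      s'.mem = s.mem ∧ (∀ i, i ≠ v + 2 → s'.reg (2 * i) = s.reg (2 * i)) ∧
      (∀ i < d + 2, i ≠ d → s'.reg (2 * i + 1) = s.reg (2 * i + 1)) ∧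
      s'.reg (2 * d + 1) = s.reg (2 * d + 1) +
        ∑ j ∈ Finset.range n, t.eval (s.reg 2) s.mem (Function.update (env s) v j) := by
  induction n with
  | zero =>
    intro s hs
    exact ⟨s, (ExecWithin.loop_done _ (by simpa [Expr.eval] using hs)).mono (by simp [Expr.cost]),
      rfl, fun _ _ => rfl, fun _ _ _ => rfl, by simp⟩
  | succ n ih =>
    intro s hs
    have a₁ := ExecWithin.assign (2 * v + 4) (.sub (.reg (2 * v + 4)) (.const 1)) s
    simp only [Expr.eval, Expr.cost, hs, Nat.add_sub_cancel] at a₁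
    obtain ⟨s₂, a₂, p₂, e₂⟩ := ht (d + 2)
      { s with reg := Function.update s.reg (2 * v + 4) n }
    have henv : env { s with reg := Function.update s.reg (2 * v + 4) n } =
        Function.update (env s) v n := by
      funext i
      simp [env, Function.update_apply]
    have h2 : Function.update s.reg (2 * v + 4) n 2 = s.reg 2 :=
      Function.update_of_ne (by omega) _ _
    simp only [henv, h2] at e₂ a₂
    have a₃ := ExecWithin.assign (2 * d + 1) (.add (.reg (2 * d + 1)) (.reg (2 * (d + 2) + 1))) s₂
    simp only [Expr.eval, Expr.cost, e₂] at a₃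
    have ev₂ : ∀ i, i ≠ v + 2 → s₂.reg (2 * i) = s.reg (2 * i) := fun i hi => by
      rw [p₂.even]; exact Function.update_of_ne (by omega) _ _
    have od₂ : ∀ i < d + 2, s₂.reg (2 * i + 1) = s.reg (2 * i + 1) := fun i hi => by
      rw [p₂.odd i hi]; exact Function.update_of_ne (by omega) _ _
    obtain ⟨s₄, a₄, m₄, ev₄, od₄, e₄⟩ := ih
      ⟨Function.update s₂.reg (2 * d + 1) (s₂.reg (2 * d + 1) +
        t.eval (s.reg 2) s.mem (Function.update (env s) v n)), s₂.mem⟩ (by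
      dsimp only
      rw [Function.update_of_ne (by omega), show 2 * v + 4 = 2 * (v + 2) by ring, p₂.even]
      exact Function.update_self _ _ _)
    dsimp only at a₄ m₄ ev₄ od₄ e₄
    have hr2 : Function.update s₂.reg (2 * d + 1) (s₂.reg (2 * d + 1) +
        t.eval (s.reg 2) s.mem (Function.update (env s) v n)) 2 = s.reg 2 := by
      rw [Function.update_of_ne (by omega)]; exact ev₂ 1 (by omega)
    rw [hr2] at a₄
    refine ⟨s₄, (ExecWithin.loop_step (by simp [Expr.eval, hs]) (a₁.seq (a₂.seq a₃)) a₄).mono ?_,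
      m₄.trans p₂.mem, ?_, ?_, ?_⟩
    · simp only [Expr.cost]; ring_nf; omega
    · intro i hi
      rw [ev₄ i hi, Function.update_of_ne (by omega), ev₂ i hi]
    · intro i hi hd
      rw [od₄ i hi hd, Function.update_of_ne (by omega), od₂ i hi]
    · rw [e₄, hr2, Function.update_self, od₂ d (by omega), Finset.sum_range_succ_comm, add_assoc]
      simp only [p₂.mem]
      congr 2
      -- The two environments differ at most in `v`, which the summation overwrites.
      refine Finset.sum_congr rfl fun j _ => congrArg (fun ρ => eval _ _ ρ t) ?_
      funext i
      rcases eq_or_ne i v with rfl | hi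
      · simp
      · rw [Function.update_of_ne hi, Function.update_of_ne hi]
        simp only [env]
        rw [Function.update_of_ne (by omega), show 2 * i + 4 = 2 * (i + 2) by ring,
          ev₂ _ (by omega)]

/-- The loop consumes the variable `v`, but its old value is parked in an odd register and restored
at the end. Hence nested sums may share a variable, as those of `mulLen` do. -/
theorem computes_sum {t : Term} (ht : t.Computes) (v : ℕ) : (sum v t).Computes := by
  intro d s
  have a₁ := ExecWithin.assign (2 * d + 1) (.const 0) s
  set s₁ : State := { s with reg := Function.update s.reg (2 * d + 1) 0 } with hs₁
  have a₂ := ExecWithin.assign (2 * (d + 1) + 1) (.reg (2 * v + 4)) s₁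
  have r₁ : s₁.reg (2 * v + 4) = s.reg (2 * v + 4) := Function.update_of_ne (by omega) _ _
  simp only [Expr.eval, Expr.cost, r₁] at a₁ a₂
  set s₂ : State :=
    { s₁ with reg := Function.update s₁.reg (2 * (d + 1) + 1) (s.reg (2 * v + 4)) } with hs₂
  have a₃ := ExecWithin.assign (2 * v + 4) (.reg 2) s₂
  have r₂ : s₂.reg 2 = s.reg 2 := by
    simp only [hs₂, hs₁]
    rw [Function.update_of_ne (by omega), Function.update_of_ne (by omega)]
  simp only [Expr.eval, Expr.cost, r₂] at a₃
  set s₃ : State := { s₂ with reg := Function.update s₂.reg (2 * v + 4) (s.reg 2) } with hs₃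
  have h₃ : ∀ i, i ≠ 2 * d + 1 → i ≠ 2 * (d + 1) + 1 → i ≠ 2 * v + 4 → s₃.reg i = s.reg i := by
    intro i h h' h''
    simp only [hs₃, hs₂, hs₁]
    rw [Function.update_of_ne h'', Function.update_of_ne h', Function.update_of_ne h]
  obtain ⟨s₄, a₄, m₄, ev₄, od₄, e₄⟩ := computes_loop ht v d (s.reg 2) s₃
    (Function.update_self _ _ _)
  rw [h₃ 2 (by omega) (by omega) (by omega)] at a₄ e₄
  have a₅ := ExecWithin.assign (2 * v + 4) (.reg (2 * (d + 1) + 1)) s₄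
  have r₄ : s₄.reg (2 * (d + 1) + 1) = s.reg (2 * v + 4) := by
    rw [od₄ (d + 1) (by omega) (by omega)]
    simp only [hs₃, hs₂]
    rw [Function.update_of_ne (by omega), Function.update_self]
  simp only [Expr.eval, Expr.cost, r₄] at a₅
  refine ⟨_, (a₁.seq (a₂.seq (a₃.seq (a₄.seq a₅)))).mono ?_, ⟨m₄, ?_, ?_⟩, ?_⟩
  · simp only [cost, eval_add, eval_mul, eval_X, eval_ofNat]; omega
  · intro i
    rcases eq_or_ne i (v + 2) with rfl | hi
    · exact Function.update_self _ _ _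
    · change Function.update _ _ _ _ = _
      rw [Function.update_of_ne (by omega), ev₄ i hi,
        h₃ _ (by omega) (by omega) (by omega)]
  · intro i hi
    change Function.update _ _ _ _ = _
    rw [Function.update_of_ne (by omega), od₄ i (by omega) (by omega),
      h₃ _ (by omega) (by omega) (by omega)]
  · change Function.update _ _ _ _ = _
    rw [Function.update_of_ne (by omega), e₄]
    have : s₃.reg (2 * d + 1) = 0 := by
      simp only [hs₃, hs₂, hs₁]
      rw [Function.update_of_ne (by omega), Function.update_of_ne (by omega), Function.update_self]
    rw [this, zero_add, eval]
    refine Finset.sum_congr rfl fun j _ => congrArg (fun ρ => eval _ _ ρ t) ?_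
    funext i
    rcases eq_or_ne i v with rfl | hi
    · simp
    · rw [Function.update_of_ne hi, Function.update_of_ne hi]
      exact h₃ _ (by omega) (by omega) (by omega)

theorem computes (t : Term) : t.Computes := by
  induction t with
  | const n =>
    exact fun d s => ⟨_, (ExecWithin.assign _ _ s).mono (by simp [Expr.cost, cost]), .update d s _,
      Function.update_self _ _ _⟩
  | len =>
    exact fun d s => ⟨_, (ExecWithin.assign _ _ s).mono (by simp [Expr.cost, cost]), .update d s _,
      Function.update_self _ _ _⟩
  | var i =>
    exact fun d s => ⟨_, (ExecWithin.assign _ _ s).mono (by simp [Expr.cost, cost]), .update d s _,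
      Function.update_self _ _ _⟩
  | cell t ht =>
    intro d s
    obtain ⟨s₁, h₁, p₁, e₁⟩ := ht d s
    refine ⟨_, (h₁.seq (ExecWithin.assign _ _ s₁)).mono (by simp [Expr.cost, cost]),
      p₁.trans (.update d s₁ _), ?_⟩
    simp [Expr.eval, e₁, p₁.mem, eval]
  | add t u ht hu =>
    intro d s
    obtain ⟨s₁, h₁, p₁, e₁, e₂⟩ := ht.binary hu d s
    refine ⟨_, ((h₁.seq (ExecWithin.assign _ _ s₁)).mono ?_).assoc,
      p₁.trans (.update d s₁ _), ?_⟩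
    · simp [Expr.cost, cost]
    · simp [Expr.eval, e₁, e₂, eval]
  | sub t u ht hu =>
    intro d s
    obtain ⟨s₁, h₁, p₁, e₁, e₂⟩ := ht.binary hu d s
    refine ⟨_, ((h₁.seq (ExecWithin.assign _ _ s₁)).mono ?_).assoc,
      p₁.trans (.update d s₁ _), ?_⟩
    · simp [Expr.cost, cost]
    · simp [Expr.eval, e₁, e₂, eval]
  | sum v t ht => exact computes_sum ht v
  | ite c t e hc ht he =>
    intro d s
    obtain ⟨s₁, h₁, p₁, e₁⟩ := hc d s
    by_cases h : c.eval (s.reg 2) s.mem (env s) = 0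
    · obtain ⟨s₂, h₂, p₂, e₂⟩ := he d s₁
      rw [p₁.reg_two] at h₂
      refine ⟨s₂, (h₁.seq (.ite_false _ (by simpa [Expr.eval, e₁] using h) h₂)).mono ?_,
        p₁.trans p₂, ?_⟩
      · simp [Expr.cost, cost]; omega
      · simp [e₂, eval, h, p₁.reg_two, p₁.mem, p₁.env_eq]
    · obtain ⟨s₂, h₂, p₂, e₂⟩ := ht d s₁
      rw [p₁.reg_two] at h₂
      refine ⟨s₂, (h₁.seq (.ite_true _ (by simpa [Expr.eval, e₁] using h) h₂)).mono ?_,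
        p₁.trans p₂, ?_⟩
      · simp [Expr.cost, cost]; omega
      · simp [e₂, eval, h, p₁.reg_two, p₁.mem, p₁.env_eq]

end Term

end RAM

/-! ## Tabulating a function given by a term -/

namespace RAM

open Polynomial

theorem reg_update_of_ne (s : State) {r i x : ℕ} (h : i ≠ r) :
    ({ s with reg := Function.update s.reg r x } : State).reg i = s.reg i :=
  Function.update_of_ne h _ _

/-- The word `w`, followed by the first `p` values of `g`, followed by zeros. -/
def tape (w : List ℕ) (g : ℕ → ℕ) (p a : ℕ) : ℕ :=
  if a < w.length then w.getD a 0 else if a < w.length + p then g (a - w.length) else 0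

theorem tape_zero (w : List ℕ) (g : ℕ → ℕ) : tape w g 0 = fun i => w.getD i 0 := by
  funext a
  by_cases h : a < w.length
  · simp [tape, h]
  · simp [tape, h, -List.getD_eq_getElem?_getD, List.getD_eq_default _ _ (not_lt.mp h)]

theorem update_tape (w : List ℕ) (g : ℕ → ℕ) (p : ℕ) :
    Function.update (tape w g p) (w.length + p) (g p) = tape w g (p + 1) := by
  funext a
  rcases eq_or_ne a (w.length + p) with rfl | h
  · simp [tape]
  · simp only [Function.update_of_ne h, tape]
    split_ifs <;> first | rfl | omega

theorem tape_of_lt {w : List ℕ} {g : ℕ → ℕ} {p a : ℕ} (h : a < w.length) :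
    tape w g p a = w.getD a 0 := by simp [tape, h]

theorem tape_length_add {w : List ℕ} {g : ℕ → ℕ} {p a : ℕ} (h : a < p) :
    tape w g p (w.length + a) = g a := by simp [tape, h]

/-- `r` nested loops, each of `len` iterations, that append the values of a term to the tape. The
variable `r - 1` belongs to the outermost loop. -/
def fill (t : Term) : ℕ → Prog
  | 0 => .seq (t.compile 0) (.seq (.store (.reg 0) (.reg 1))
      (.assign 0 (.add (.reg 0) (.const 1))))
  | r + 1 => .seq (.assign (2 * r + 4) (.const 0)) <|
      .loop (.sub (.reg 2) (.reg (2 * r + 4))) <|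
        .seq (fill t r) (.assign (2 * r + 4) (.add (.reg (2 * r + 4)) (.const 1)))

/-- A bound on the number of operations of `fill`. -/
noncomputable def fillCost (t : Term) : ℕ → ℕ[X]
  | 0 => t.cost + 10
  | r + 1 => X * (fillCost t r + 8) + 10

/-- The word `w` and the first `p` values of `g` have been written. -/
structure Written (w : List ℕ) (g : ℕ → ℕ) (p : ℕ) (s : State) : Prop where
  len : s.reg 2 = w.length
  top : s.reg 0 = w.length + p
  mem : s.mem = tape w g p

theorem Written.update {w : List ℕ} {g : ℕ → ℕ} {p : ℕ} {s : State} (h : Written w g p s)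
    (v x : ℕ) : Written w g p { s with reg := Function.update s.reg (2 * v + 4) x } :=
  ⟨(reg_update_of_ne s (show 2 ≠ 2 * v + 4 by omega)).trans h.len,
    (reg_update_of_ne s (show 0 ≠ 2 * v + 4 by omega)).trans h.top, h.mem⟩

theorem env_update (s : State) (v x : ℕ) :
    Term.env { s with reg := Function.update s.reg (2 * v + 4) x } =
      Function.update (Term.env s) v x := by
  funext i
  simp [Term.env, Function.update_apply]

/-- After `n` digits that begin with `q`, the term yields the values of `g`. -/
def Tabulates (t : Term) (w : List ℕ) (g : ℕ → ℕ) (r q : ℕ) (σ : ℕ → ℕ) : Prop :=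
  ∀ ρ : ℕ → ℕ, (∀ i, r ≤ i → ρ i = σ i) → (∀ i < r, ρ i < w.length) →
    t.eval w.length (tape w g (q * w.length ^ r + ∑ i ∈ Finset.range r, ρ i * w.length ^ i)) ρ =
      g (q * w.length ^ r + ∑ i ∈ Finset.range r, ρ i * w.length ^ i)

/-- Fixing one more digit `j` extends the leading digits from `q` to `q * l + j`, where `l` is the
length of `w`; the indices of the entries stay the same. -/
theorem Tabulates.step {t : Term} {w : List ℕ} {g : ℕ → ℕ} {r q : ℕ} {σ : ℕ → ℕ}
    (h : Tabulates t w g (r + 1) q σ) {j : ℕ} (hj : j < w.length) {τ : ℕ → ℕ} (hτ : τ r = j)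
    (hτ' : ∀ i, r < i → τ i = σ i) : Tabulates t w g r (q * w.length + j) τ := by
  intro ρ hρ hρ'
  have := h ρ (fun i hi => (hρ i (by omega)).trans (hτ' i hi)) (fun i hi => by
    rcases Nat.lt_succ_iff_lt_or_eq.mp hi with hi | rfl
    · exact hρ' i hi
    · rwa [hρ i le_rfl, hτ])
  have hq : q * w.length ^ (r + 1) + (∑ i ∈ Finset.range r, ρ i * w.length ^ i + j * w.length ^ r) =
      (q * w.length + j) * w.length ^ r + ∑ i ∈ Finset.range r, ρ i * w.length ^ i := by ring
  rwa [Finset.sum_range_succ, hρ r le_rfl, hτ, hq] at this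

/-- Induction on the number of loops. With leading digits `q`, the inner `r` loops write the entries
from `q * l ^ r` up to, but excluding, `(q + 1) * l ^ r` in increasing order, where `l` is the
length of `w`. When `t` is evaluated for an entry, exactly the smaller entries are on the tape, so
`t` may describe a recursion that reads them back. -/
theorem execWithin_fill (t : Term) (w : List ℕ) (g : ℕ → ℕ) (r : ℕ) : ∀ (q : ℕ) (s : State),
    Written w g (q * w.length ^ r) s → Tabulates t w g r q (Term.env s) →
    ∃ s', ExecWithin (fill t r) s ((fillCost t r).eval w.length) s' ∧
      Written w g ((q + 1) * w.length ^ r) s' ∧ ∀ i, r ≤ i → Term.env s' i = Term.env s i := by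
  induction r with
  | zero =>
    intro q s hs ht
    obtain ⟨s₁, h₁, p₁, e₁⟩ := t.computes 0 s
    have h₂ := ExecWithin.store (.reg 0) (.reg 1) s₁
    have h₃ := ExecWithin.assign 0 (.add (.reg 0) (.const 1))
      { s₁ with mem := Function.update s₁.mem (s₁.reg 0) (s₁.reg 1) }
    have hq := ht (Term.env s) (fun _ _ => rfl) (by simp)
    have hm := hs.mem
    have htop := hs.top
    simp only [Finset.range_zero, Finset.sum_empty, add_zero, pow_zero, mul_one] at hq hm htop ⊢
    have r0 : s₁.reg 0 = w.length + q := (p₁.even 0).trans htop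
    have r1 : s₁.reg 1 = g q := by
      rw [← hq, ← hm, ← hs.len]
      exact e₁
    rw [hs.len] at h₁
    refine ⟨_, (h₁.seq (h₂.seq h₃)).mono ?_, ⟨?_, ?_, ?_⟩, ?_⟩
    · simp [fillCost, Expr.cost]
    · exact (reg_update_of_ne _ (show 2 ≠ 0 by omega)).trans (p₁.reg_two.trans hs.len)
    · simp [Expr.eval, r0, add_assoc]
    · change Function.update s₁.mem (s₁.reg 0) (s₁.reg 1) = _
      rw [r0, r1, p₁.mem, hm, update_tape]
    · intro i _
      exact (reg_update_of_ne _ (show 2 * i + 4 ≠ 0 by omega)).trans (congrFun p₁.env_eq i)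
  | succ r ih =>
    intro q s hs ht
    -- `j` is the current digit and `n` the number of iterations that are left.
    have loop : ∀ (n j : ℕ) (s₁ : State), j + n = w.length →
        Written w g ((q * w.length + j) * w.length ^ r) s₁ → Term.env s₁ r = j →
        (∀ i, r < i → Term.env s₁ i = Term.env s i) →
        ∃ s', ExecWithin (.loop (.sub (.reg 2) (.reg (2 * r + 4))) <|
            .seq (fill t r) (.assign (2 * r + 4) (.add (.reg (2 * r + 4)) (.const 1)))) s₁
            (n * ((fillCost t r).eval w.length + 8) + 4) s' ∧
          Written w g ((q + 1) * w.length ^ (r + 1)) s' ∧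
          ∀ i, r < i → Term.env s' i = Term.env s i := by
      intro n
      induction n with
      | zero =>
        intro j s₁ hj h₁ hr he
        obtain rfl : j = w.length := hj
        refine ⟨s₁, (ExecWithin.loop_done _ ?_).mono (by simp [Expr.cost]), ?_, he⟩
        · simp only [Expr.eval, h₁.len]
          exact Nat.sub_eq_zero_of_le hr.ge
        · rwa [show (q + 1) * w.length ^ (r + 1) = (q * w.length + w.length) * w.length ^ r by ring]
      | succ n ihn =>
        intro j s₁ hj h₁ hr he
        obtain ⟨s₂, a₂, h₂, e₂⟩ := ih _ s₁ h₁ (ht.step (by omega) hr he)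
        have a₃ := ExecWithin.assign (2 * r + 4) (.add (.reg (2 * r + 4)) (.const 1)) s₂
        have r₂ : s₂.reg (2 * r + 4) = j := (e₂ r le_rfl).trans hr
        simp only [Expr.eval, Expr.cost, r₂] at a₃
        obtain ⟨s₄, a₄, h₄, e₄⟩ := ihn (j + 1) _ (by omega) (h₂.update r (j + 1))
          (by rw [env_update, Function.update_self]) (fun i hi => by
            rw [env_update, Function.update_of_ne (by omega), e₂ i hi.le, he i hi])
        refine ⟨s₄, (ExecWithin.loop_step ?_ (a₂.seq a₃) a₄).mono ?_, h₄, e₄⟩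
        · have : s₁.reg (2 * r + 4) = j := hr
          simp only [Expr.eval, h₁.len, this]
          omega
        · simp only [Expr.cost]; ring_nf; omega
    have a₁ := ExecWithin.assign (2 * r + 4) (.const 0) s
    have h₁ : Written w g ((q * w.length + 0) * w.length ^ r) s := by
      rwa [show (q * w.length + 0) * w.length ^ r = q * w.length ^ (r + 1) by ring]
    obtain ⟨s', a₂, h₂, e₂⟩ := loop w.length 0 _ (zero_add _) (h₁.update r 0)
      (by rw [env_update, Function.update_self])
      (fun i hi => by rw [env_update, Function.update_of_ne (by omega)])
    refine ⟨s', (a₁.seq a₂).mono ?_, h₂, e₂⟩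
    simp [fillCost, Expr.cost]
    omega

/-- Fill the tape by `r` nested loops with the values of `t`, and return the value of `out`. -/
def fillAndReturn (t : Term) (r : ℕ) (out : Term) : Prog :=
  .seq (.assign 2 (.reg 0)) <| .seq (fill t r) <| .seq (out.compile 0) <| .assign 0 (.reg 1)

theorem fillAndReturn_testsWithin (t : Term) (r : ℕ) (out : Term) (w : List ℕ) (g : ℕ → ℕ)
    (P : Prop)
    (ht : ∀ ρ : ℕ → ℕ, (∀ i < r, ρ i < w.length) →
      t.eval w.length (tape w g (∑ i ∈ Finset.range r, ρ i * w.length ^ i)) ρ =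
        g (∑ i ∈ Finset.range r, ρ i * w.length ^ i))
    (hP : ∀ ρ, P → out.eval w.length (tape w g (w.length ^ r)) ρ = 1)
    (hnP : ∀ ρ, ¬ P → out.eval w.length (tape w g (w.length ^ r)) ρ = 0) :
    (fillAndReturn t r out).TestsWithin w P
      ((fillCost t r + out.cost + 4).eval w.length) := by
  have h₁ := ExecWithin.assign 2 (.reg 0) (initial w)
  have w₁ : Written w g (0 * w.length ^ r)
      { initial w with reg := Function.update (initial w).reg 2 ((Expr.reg 0).eval (initial w)) } :=
    ⟨by simp [Expr.eval, initial], by simp [initial], by rw [zero_mul, tape_zero]; rfl⟩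
  -- There are no outer digits, so `q = 0`, and all `w.length ^ r` entries get written.
  obtain ⟨s₂, h₂, w₂, -⟩ := execWithin_fill t w g r 0 _ w₁ (fun ρ _ hρ => by
    simpa using ht ρ hρ)
  obtain ⟨s₃, h₃, p₃, e₃⟩ := out.computes 0 s₂
  rw [w₂.len, w₂.mem, zero_add, one_mul] at e₃
  rw [w₂.len] at h₃
  obtain ⟨k, hk, h⟩ := h₁.seq (h₂.seq (h₃.seq (ExecWithin.assign 0 (.reg 1) s₃)))
  refine ⟨k, _, h, hk.trans ?_, fun h => ?_, fun h => ?_⟩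
  · simp [Expr.cost]; omega
  · exact (Function.update_self 0 (s₃.reg 1) s₃.reg).trans (e₃.trans (hP _ h))
  · exact (Function.update_self 0 (s₃.reg 1) s₃.reg).trans (e₃.trans (hnP _ h))

end RAM

/-! ## Counting pairs of walks with the same word -/

/-- Linear recurrences: if a linear functional vanishes on `x, A x, …, A ^ (d - 1) x`, where `d` is
the dimension, then it vanishes on all `A ^ k x`. -/
theorem Module.End.apply_pow_eq_zero_of_lt_finrank {R M : Type*} [CommRing R] [Nontrivial R]
    [AddCommGroup M] [Module R M] [Module.Free R M] [Module.Finite R M] (A : Module.End R M)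
    (φ : M →ₗ[R] R) (x : M) (h : ∀ k < Module.finrank R M, φ ((A ^ k) x) = 0) (k : ℕ) :
    φ ((A ^ k) x) = 0 := by
  induction k using Nat.strong_induction_on with
  | _ k ih =>
    rcases lt_or_ge k (Module.finrank R M) with hk | hk
    · exact h k hk
    · obtain ⟨j, rfl⟩ := Nat.exists_eq_add_of_le' hk
      -- Cayley–Hamilton: the characteristic polynomial is monic, so `A ^ d` is a combination of
      -- lower powers. After multiplication by `A ^ j`, all exponents that remain are below `j + d`.
      have hA := A.aeval_self_charpoly
      rw [Polynomial.aeval_eq_sum_range, A.charpoly_natDegree, Finset.sum_range_succ,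
        ← A.charpoly_natDegree, A.charpoly_monic.coeff_natDegree, one_smul, A.charpoly_natDegree,
        add_eq_zero_iff_eq_neg'] at hA
      rw [pow_add, hA]
      simp only [mul_neg, LinearMap.neg_apply, map_neg, neg_eq_zero, Finset.mul_sum,
        LinearMap.sum_apply, map_sum, mul_smul_comm, LinearMap.smul_apply, map_smul, ← pow_add]
      exact Finset.sum_eq_zero fun i hi => by
        rw [ih _ (by simpa using hi), smul_zero]

/-- Finite graphs whose nodes and edges have identifiers, with a set of source nodes, a set of
target nodes and a partition of the nodes into two sides. -/
structure Net (V W : Type) where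
  src : W → V
  tgt : W → V
  nodeId : V → ℕ
  edgeId : W → ℕ
  S : Set V
  T : Set V
  side : V → Bool

/-! ### Pairs of walks: a linear recurrence and a sum of squares -/

namespace Net

open Finset

open scoped Classical

variable {V W : Type} [Fintype W] (R : Net V W)

/-- The number of walks from `v` to a target node with a given sequence of edge identifiers. -/
noncomputable def count : List ℕ → V → ℕ
  | [], v => if v ∈ R.T then 1 else 0
  | e :: l, v => ∑ f, if R.src f = v ∧ R.edgeId f = e then count l (R.tgt f) else 0

/-- The number of pairs of walks of length `k` from `v` and `v'` to target nodes with the same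
sequence of edge identifiers. -/
noncomputable def pairs : ℕ → V → V → ℕ
  | 0, v, v' => if v ∈ R.T ∧ v' ∈ R.T then 1 else 0
  | k + 1, v, v' => ∑ f, ∑ f', if R.src f = v ∧ R.src f' = v' ∧ R.edgeId f = R.edgeId f' then
      pairs k (R.tgt f) (R.tgt f') else 0

/-- The sequences of `k` edge identifiers. -/
noncomputable def words : ℕ → Finset (List ℕ)
  | 0 => {[]}
  | k + 1 => (univ.image R.edgeId ×ˢ words k).image fun p => p.1 :: p.2

theorem sum_words_succ {M : Type*} [AddCommMonoid M] (k : ℕ) (g : List ℕ → M) :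
    ∑ l ∈ R.words (k + 1), g l = ∑ e ∈ univ.image R.edgeId, ∑ l ∈ R.words k, g (e :: l) := by
  rw [words, sum_image (fun p _ q _ h => by simpa [Prod.ext_iff] using h), sum_product]

/-- Group the pairs by their common word; once the word is fixed, the two walks are chosen
independently. -/
theorem pairs_eq_sum (k : ℕ) : ∀ v v',
    R.pairs k v v' = ∑ l ∈ R.words k, R.count l v * R.count l v' := by
  induction k with
  | zero =>
    intro v v'
    by_cases h : v ∈ R.T <;> by_cases h' : v' ∈ R.T <;> simp [pairs, words, count, h, h']
  | succ k ih =>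
    intro v v'
    rw [sum_words_succ]
    simp only [count, sum_mul_sum, pairs]
    simp_rw [sum_comm (s := R.words k), sum_comm (s := univ.image R.edgeId)]
    refine sum_congr rfl fun f _ => sum_congr rfl fun f' _ => ?_
    -- Only words that begin with the identifier of `f` contribute.
    rw [sum_comm (s := R.words k), sum_eq_single_of_mem (R.edgeId f) (mem_image_of_mem _ (mem_univ _))]
    · by_cases h : R.src f = v <;> by_cases h' : R.src f' = v' <;>
        by_cases h'' : R.edgeId f = R.edgeId f' <;>
        simp [h, h', h'', ih, eq_comm (a := R.edgeId f')]
    · intro e _ he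
      exact sum_eq_zero fun l _ => by simp [he.symm]

/-- A letter that is no edge identifier admits no walk, so the finite set `words k` loses nothing.
-/
theorem count_eq_zero {l : List ℕ} : ∀ {k : ℕ}, l.length = k → l ∉ R.words k → ∀ v,
    R.count l v = 0 := by
  induction l with
  | nil => rintro k rfl h; simp [words] at h
  | cons e l ih =>
    rintro k rfl h v
    refine sum_eq_zero fun f _ => ?_
    split_ifs with hf
    · refine ih rfl (fun hl => h ?_) _
      exact mem_image.mpr ⟨(e, l), mem_product.mpr ⟨mem_image.mpr ⟨f, mem_univ _, hf.2⟩, hl⟩, rfl⟩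
    · rfl

/-- The linear map that takes `pairs k` to `pairs (k + 1)`. -/
noncomputable def stepMap : Module.End ℤ (V × V → ℤ) :=
  LinearMap.pi fun p => ∑ f, ∑ f',
    (if R.src f = p.1 ∧ R.src f' = p.2 ∧ R.edgeId f = R.edgeId f' then 1 else 0 : ℤ) •
      LinearMap.proj (R.tgt f, R.tgt f')

theorem stepMap_pow (k : ℕ) : (R.stepMap ^ k) (fun p => (R.pairs 0 p.1 p.2 : ℤ)) =
    fun p => (R.pairs k p.1 p.2 : ℤ) := by
  induction k with
  | zero => rfl
  | succ k ih =>
    rw [pow_succ', Module.End.mul_apply, ih]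
    funext p
    simp only [stepMap, LinearMap.pi_apply, LinearMap.sum_apply, LinearMap.smul_apply,
      LinearMap.proj_apply, smul_eq_mul, pairs]
    push_cast
    simp

variable [Fintype V]

/-- The signed number of walks from source nodes with identifier `a` to target nodes. -/
noncomputable def signedCount (a : ℕ) (l : List ℕ) : ℤ :=
  ∑ v, if v ∈ R.S ∧ R.nodeId v = a then (if R.side v then -1 else 1) * (R.count l v : ℤ) else 0

/-- The number of pairs of walks from source nodes with the same identifier on the same side. -/
noncomputable def same (k : ℕ) : ℕ :=
  ∑ v, ∑ v', if v ∈ R.S ∧ v' ∈ R.S ∧ R.nodeId v = R.nodeId v' ∧ R.side v = R.side v' then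
    R.pairs k v v' else 0

/-- The number of pairs of walks from source nodes with the same identifier on opposite sides. -/
noncomputable def opposite (k : ℕ) : ℕ :=
  ∑ v, ∑ v', if v ∈ R.S ∧ v' ∈ R.S ∧ R.nodeId v = R.nodeId v' ∧ R.side v ≠ R.side v' then
    R.pairs k v v' else 0

/-- `same k - opposite k` as a linear functional of `pairs k`. -/
noncomputable def form : (V × V → ℤ) →ₗ[ℤ] ℤ :=
  ∑ v, ∑ v', (if v ∈ R.S ∧ v' ∈ R.S ∧ R.nodeId v = R.nodeId v' then
    (if R.side v = R.side v' then 1 else -1) else 0 : ℤ) • LinearMap.proj (v, v')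

omit [Fintype W] in
theorem form_apply (x : V × V → ℤ) : R.form x =
    ∑ v, ∑ v', (if v ∈ R.S ∧ v' ∈ R.S ∧ R.nodeId v = R.nodeId v' then
      (if R.side v = R.side v' then 1 else -1) else 0 : ℤ) * x (v, v') := by
  simp only [form, LinearMap.sum_apply, LinearMap.smul_apply, LinearMap.proj_apply, smul_eq_mul]

theorem form_pairs (k : ℕ) :
    R.form (fun p => (R.pairs k p.1 p.2 : ℤ)) = R.same k - R.opposite k := by
  rw [form_apply, same, opposite]
  push_cast
  simp only [← sum_sub_distrib]
  refine sum_congr rfl fun v _ => sum_congr rfl fun v' _ => ?_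
  by_cases h : v ∈ R.S ∧ v' ∈ R.S ∧ R.nodeId v = R.nodeId v' <;>
    by_cases h' : R.side v = R.side v' <;> simp [h, h']

/-- Expanding a squared signed count yields pairs of source nodes weighted by the product of their
signs, which is `1` on the same side and `-1` on opposite sides; summation over the words turns
products of counts into `pairs`. This is what makes `same k - opposite k` nonnegative and links it
to the single signed counts. -/
theorem form_pairs_eq_sum_sq (k : ℕ) : R.form (fun p => (R.pairs k p.1 p.2 : ℤ)) =
    ∑ a ∈ univ.image R.nodeId, ∑ l ∈ R.words k, R.signedCount a l ^ 2 := by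
  simp only [form_apply, sq, signedCount, sum_mul_sum, pairs_eq_sum]
  simp_rw [sum_comm (s := R.words k), sum_comm (s := univ.image R.nodeId)]
  refine sum_congr rfl fun v _ => sum_congr rfl fun v' _ => ?_
  rw [sum_comm (s := R.words k), sum_eq_single_of_mem (R.nodeId v) (mem_image_of_mem _ (mem_univ _))]
  · push_cast
    rw [mul_sum]
    refine sum_congr rfl fun l _ => ?_
    by_cases h : v ∈ R.S <;> by_cases h' : v' ∈ R.S <;>
      by_cases h'' : R.nodeId v = R.nodeId v' <;>
      cases hs : R.side v <;> cases hs' : R.side v' <;>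
      simp [h, h', h'', eq_comm (a := R.nodeId v')]
  · intro a _ ha
    exact sum_eq_zero fun l _ => by simp [ha.symm]

/-- The signed numbers of walks all vanish if and only if the first numbers of pairs of walks on
the same side and on opposite sides agree. -/
theorem same_le_opposite_iff {K : ℕ} (hK : Fintype.card V * Fintype.card V ≤ K) :
    (∀ k < K, R.same k ≤ R.opposite k) ↔ ∀ a l, R.signedCount a l = 0 := by
  have hform : ∀ k, R.same k ≤ R.opposite k ↔
      R.form ((R.stepMap ^ k) (fun p => (R.pairs 0 p.1 p.2 : ℤ))) = 0 := by
    intro k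
    rw [stepMap_pow]
    have h₁ := R.form_pairs k
    -- The difference is a sum of squares, so `≤` already forces equality.
    have h₂ : 0 ≤ R.form (fun p => (R.pairs k p.1 p.2 : ℤ)) := by
      rw [form_pairs_eq_sum_sq]; positivity
    omega
  constructor
  · intro h a l
    -- The space `V × V → ℤ` has dimension `|V| ^ 2 ≤ K`, so the tested lengths settle all lengths.
    have h₀ := Module.End.apply_pow_eq_zero_of_lt_finrank R.stepMap R.form
      (fun p => (R.pairs 0 p.1 p.2 : ℤ)) (fun k hk => (hform k).mp (h k (by
        rw [Module.finrank_pi, Fintype.card_prod] at hk; omega))) l.length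
    rw [stepMap_pow, form_pairs_eq_sum_sq] at h₀
    by_cases ha : a ∈ univ.image R.nodeId
    · by_cases hl : l ∈ R.words l.length
      · have := (sum_eq_zero_iff_of_nonneg fun a _ => by positivity).mp h₀ a ha
        have := (sum_eq_zero_iff_of_nonneg fun l _ => by positivity).mp this l hl
        exact pow_eq_zero_iff two_ne_zero |>.mp this
      · simp [signedCount, R.count_eq_zero rfl hl]
    · refine sum_eq_zero fun v _ => if_neg fun hv => ha ?_
      exact mem_image.mpr ⟨v, mem_univ _, hv.2⟩
  · intro h k _
    rw [hform, stepMap_pow, form_pairs_eq_sum_sq]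
    simp [h]

end Net

/-! ## The equivalence test as a program -/

/-- Lets a program sum over all pairs of numbers below `l` instead of the elements of `W`: pairs
that code nothing contribute `0`. -/
theorem Finset.sum_range_range_eq_sum {W : Type*} [Fintype W] {l : ℕ} {c : W → ℕ × ℕ}
    (hc : Function.Injective c) (hl : ∀ f, (c f).1 < l ∧ (c f).2 < l) (F : ℕ → ℕ → ℕ) (G : W → ℕ)
    (hG : ∀ f, F (c f).1 (c f).2 = G f) (h0 : ∀ a b, (∀ f, c f ≠ (a, b)) → F a b = 0) :
    ∑ a ∈ Finset.range l, ∑ b ∈ Finset.range l, F a b = ∑ f, G f := by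
  rw [← Finset.sum_product']
  refine (Finset.sum_of_injOn c hc.injOn (fun f _ => ?_) (fun p _ hp => ?_)
    fun f _ => (hG f).symm).symm
  · simpa using hl f
  · exact h0 _ _ fun f hf => hp ⟨f, by simp, hf⟩

namespace RAM

namespace Term

/-- The value of `t` if the values of `x` and `y` are equal, and `0` otherwise. -/
def ifEq (x y t : Term) : Term := ite (sub x y) (const 0) (ite (sub y x) (const 0) t)

/-- The value of `t` if the values of `x` and `y` are different, and `0` otherwise. -/
def ifNe (x y t : Term) : Term := ite (sub x y) t (ite (sub y x) t (const 0))

/-- The product of `len` and `t`, which must not contain the variable `12`. -/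
def mulLen (t : Term) : Term := sum 12 t

/-- The number with digits `a`, `b`, `c`, `d` in base `len`. -/
def digits (a b c d : Term) : Term :=
  add (mulLen (add (mulLen (add (mulLen a) b)) c)) d

/-- The address of the tape cell with index `a`, `b`, `c`, `d` in the block of the tape that is
given by the variables `4` to `7`. -/
def address (a b c d : Term) : Term :=
  add len (add (mulLen (mulLen (mulLen (mulLen (digits (var 7) (var 6) (var 5) (var 4))))))
    (digits a b c d))

theorem eval_ifEq (l : ℕ) (M ρ : ℕ → ℕ) (x y t : Term) : (ifEq x y t).eval l M ρ =
    if x.eval l M ρ = y.eval l M ρ then t.eval l M ρ else 0 := by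
  simp only [ifEq, eval]
  grind

theorem eval_ifNe (l : ℕ) (M ρ : ℕ → ℕ) (x y t : Term) : (ifNe x y t).eval l M ρ =
    if x.eval l M ρ ≠ y.eval l M ρ then t.eval l M ρ else 0 := by
  simp only [ifNe, eval]
  grind

/-- The term has the value `x`, independently of the variable `12`. -/
def HasValue (l : ℕ) (M ρ : ℕ → ℕ) (t : Term) (x : ℕ) : Prop :=
  ∀ j, t.eval l M (Function.update ρ 12 j) = x

theorem HasValue.eval_eq {l x : ℕ} {M ρ : ℕ → ℕ} {t : Term} (h : HasValue l M ρ t x) :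
    t.eval l M ρ = x := by simpa using h (ρ 12)

theorem HasValue.var {l : ℕ} {M ρ : ℕ → ℕ} {i : ℕ} (h : i ≠ 12) : HasValue l M ρ (var i) (ρ i) :=
  fun _ => Function.update_of_ne h _ _

theorem HasValue.add {l x y : ℕ} {M ρ : ℕ → ℕ} {t u : Term} (h : HasValue l M ρ t x)
    (h' : HasValue l M ρ u y) : HasValue l M ρ (add t u) (x + y) := fun j => by
  rw [eval, h j, h' j]

theorem HasValue.mulLen {l x : ℕ} {M ρ : ℕ → ℕ} {t : Term} (h : HasValue l M ρ t x) :
    HasValue l M ρ (mulLen t) (x * l) := fun j => by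
  simp [Term.mulLen, eval, h _, mul_comm]

theorem HasValue.digits {l x y z u : ℕ} {M ρ : ℕ → ℕ} {a b c d : Term} (ha : HasValue l M ρ a x)
    (hb : HasValue l M ρ b y) (hc : HasValue l M ρ c z) (hd : HasValue l M ρ d u) :
    HasValue l M ρ (digits a b c d) (((x * l + y) * l + z) * l + u) :=
  ((((ha.mulLen).add hb).mulLen.add hc).mulLen).add hd

/-- The leading `l` skips the input word, and the block number, the walk length, is shifted past the
four digits of the two nodes. -/
theorem HasValue.address {l x y z u : ℕ} {M ρ : ℕ → ℕ} {a b c d : Term} (ha : HasValue l M ρ a x)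
    (hb : HasValue l M ρ b y) (hc : HasValue l M ρ c z) (hd : HasValue l M ρ d u) :
    HasValue l M ρ (address a b c d) (l + ((((ρ 7 * l + ρ 6) * l + ρ 5) * l + ρ 4) * l ^ 4 +
      (((x * l + y) * l + z) * l + u))) := fun j => by
  have h : HasValue l M ρ (Term.digits (Term.var 7) (Term.var 6) (Term.var 5) (Term.var 4))
      (((ρ 7 * l + ρ 6) * l + ρ 5) * l + ρ 4) :=
    .digits (.var (by norm_num)) (.var (by norm_num)) (.var (by norm_num)) (.var (by norm_num))
  have := (h.mulLen.mulLen.mulLen.mulLen.add (ha.digits hb hc hd)) j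
  rw [Term.address, eval, this, eval]
  ring

end Term

/-- Terms that give access to a net whose nodes and edges are coded by pairs of numbers. -/
structure Access where
  source : Term → Term → Term
  target : Term → Term → Term
  nodeId : Term → Term → Term
  side : Term → Term → Term
  edge : Term → Term → Term
  edgeId : Term → Term → Term
  srcFst : Term → Term → Term
  srcSnd : Term → Term → Term
  tgtFst : Term → Term → Term
  tgtSnd : Term → Term → Term

/-- The access terms of an edge `f`, coded by the values of `x` and `y`, have the right values. -/
structure Access.EdgeSpec (A : Access) {V W : Type} (R : Net V W) (cV : V → ℕ × ℕ) (l : ℕ)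
    (M ρ : ℕ → ℕ) (x y : Term) (f : W) : Prop where
  edge : (A.edge x y).eval l M ρ ≠ 0
  edgeId : (A.edgeId x y).eval l M ρ = R.edgeId f
  srcFst : (A.srcFst x y).eval l M ρ = (cV (R.src f)).1
  srcSnd : (A.srcSnd x y).eval l M ρ = (cV (R.src f)).2
  tgtFst : (A.tgtFst x y).eval l M ρ = (cV (R.tgt f)).1
  tgtSnd : (A.tgtSnd x y).eval l M ρ = (cV (R.tgt f)).2

/-- The terms give access to the net `R` in every memory that begins with the word `w`. -/
structure Access.Represents (A : Access) {V W : Type} (R : Net V W) (w : List ℕ) (cV : V → ℕ × ℕ)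
    (cW : W → ℕ × ℕ) : Prop where
  node_lt : ∀ v, (cV v).1 < w.length ∧ (cV v).2 < w.length
  edge_lt : ∀ f, (cW f).1 < w.length ∧ (cW f).2 < w.length
  node_inj : Function.Injective cV
  edge_inj : Function.Injective cW
  source : ∀ M : ℕ → ℕ, (∀ i < w.length, M i = w.getD i 0) → ∀ ρ x y,
    (A.source x y).eval w.length M ρ ≠ 0 ↔
      ∃ v ∈ R.S, cV v = (x.eval w.length M ρ, y.eval w.length M ρ)
  target : ∀ M : ℕ → ℕ, (∀ i < w.length, M i = w.getD i 0) → ∀ ρ x y,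
    (A.target x y).eval w.length M ρ ≠ 0 ↔
      ∃ v ∈ R.T, cV v = (x.eval w.length M ρ, y.eval w.length M ρ)
  nodeId : ∀ M : ℕ → ℕ, (∀ i < w.length, M i = w.getD i 0) → ∀ ρ x y v,
    cV v = (x.eval w.length M ρ, y.eval w.length M ρ) →
    (A.nodeId x y).eval w.length M ρ = R.nodeId v
  side : ∀ M : ℕ → ℕ, (∀ i < w.length, M i = w.getD i 0) → ∀ ρ x y v,
    cV v = (x.eval w.length M ρ, y.eval w.length M ρ) →
    (A.side x y).eval w.length M ρ = (R.side v).toNat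
  exists_edge : ∀ M : ℕ → ℕ, (∀ i < w.length, M i = w.getD i 0) → ∀ ρ x y,
    (A.edge x y).eval w.length M ρ ≠ 0 →
    ∃ f, cW f = (x.eval w.length M ρ, y.eval w.length M ρ)
  edge : ∀ M : ℕ → ℕ, (∀ i < w.length, M i = w.getD i 0) → ∀ ρ x y f,
    cW f = (x.eval w.length M ρ, y.eval w.length M ρ) →
    A.EdgeSpec R cV w.length M ρ x y f

namespace Access

open Term Finset

variable (A : Access)

/-- The number of pairs of walks of length `0`. -/
def baseTerm : Term :=
  ite (A.target (var 3) (var 2)) (ite (A.target (var 1) (var 0)) (const 1) (const 0)) (const 0)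

/-- The contribution of two edges to the number of pairs of walks of positive length. -/
def edgePairTerm : Term :=
  ite (A.edge (var 8) (var 9)) (ite (A.edge (var 10) (var 11))
    (ifEq (A.edgeId (var 8) (var 9)) (A.edgeId (var 10) (var 11))
    (ifEq (A.srcFst (var 8) (var 9)) (var 3) (ifEq (A.srcSnd (var 8) (var 9)) (var 2)
    (ifEq (A.srcFst (var 10) (var 11)) (var 1) (ifEq (A.srcSnd (var 10) (var 11)) (var 0)
    (cell (sub (address (A.tgtFst (var 8) (var 9)) (A.tgtSnd (var 8) (var 9))
      (A.tgtFst (var 10) (var 11)) (A.tgtSnd (var 10) (var 11)))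
      (mulLen (mulLen (mulLen (mulLen (const 1)))))))))))) (const 0)) (const 0)

/-- The number of pairs of walks of positive length. -/
def stepTerm : Term := sum 8 (sum 9 (sum 10 (sum 11 A.edgePairTerm)))

/-- The number of pairs of walks whose length is given by the variables `4` to `7`, from the
nodes that are given by the variables `0` to `3`. -/
def pairsTerm : Term :=
  ite (add (add (var 7) (var 6)) (add (var 5) (var 4))) A.stepTerm A.baseTerm

/-- A sum over all pairs of source nodes with equal identifiers. -/
def sourcePairs (t : Term) : Term :=
  sum 3 (sum 2 (sum 1 (sum 0 (ite (A.source (var 3) (var 2)) (ite (A.source (var 1) (var 0))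
    (ifEq (A.nodeId (var 3) (var 2)) (A.nodeId (var 1) (var 0)) t) (const 0)) (const 0)))))

/-- The excess of pairs on the same side over pairs on opposite sides. -/
def excessTerm : Term :=
  sub (A.sourcePairs (ifEq (A.side (var 3) (var 2)) (A.side (var 1) (var 0))
      (cell (address (var 3) (var 2) (var 1) (var 0)))))
    (A.sourcePairs (ifNe (A.side (var 3) (var 2)) (A.side (var 1) (var 0))
      (cell (address (var 3) (var 2) (var 1) (var 0)))))

/-- The result of the test. -/
def resultTerm : Term := sub (const 1) (sum 7 (sum 6 (sum 5 (sum 4 A.excessTerm))))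

/-- The program that tests whether all signed numbers of walks vanish. -/
def program : Prog := fillAndReturn A.pairsTerm 8 A.resultTerm

/-- The running time of the program. -/
noncomputable def time : Polynomial ℕ := fillCost A.pairsTerm 8 + A.resultTerm.cost + 4

end Access

theorem digit_lt {l n x b : ℕ} (hx : x < l ^ n) (hb : b < l) : x * l + b < l ^ (n + 1) := by
  calc x * l + b < x * l + l := by omega
    _ = (x + 1) * l := by ring
    _ ≤ l ^ n * l := by gcongr; omega
    _ = l ^ (n + 1) := by ring

theorem digit_inj {l x b x' b' : ℕ} (hb : b < l) (hb' : b' < l) :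
    x * l + b = x' * l + b' ↔ x = x' ∧ b = b' := by
  refine ⟨fun h => ?_, by rintro ⟨rfl, rfl⟩; rfl⟩
  have hl : 0 < l := by omega
  have h₁ := congrArg (· / l) h
  have h₂ := congrArg (· % l) h
  simp only [Nat.mul_comm _ l, Nat.mul_add_div hl, Nat.div_eq_of_lt hb, Nat.div_eq_of_lt hb',
    Nat.mul_add_mod, Nat.mod_eq_of_lt hb, Nat.mod_eq_of_lt hb', add_zero] at h₁ h₂
  exact ⟨h₁, h₂⟩

theorem exists_digits {l k : ℕ} (hk : k < l ^ 4) :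
    ∃ a < l, ∃ b < l, ∃ c < l, ∃ d < l, k = ((a * l + b) * l + c) * l + d := by
  have hl : 0 < l := Nat.pos_of_ne_zero fun h => by simp [h] at hk
  refine ⟨k / l / l / l, ?_, k / l / l % l, Nat.mod_lt _ hl, k / l % l, Nat.mod_lt _ hl, k % l,
    Nat.mod_lt _ hl, ?_⟩
  · rw [Nat.div_div_eq_div_mul, Nat.div_div_eq_div_mul, Nat.div_lt_iff_lt_mul (by positivity)]
    calc k < l ^ 4 := hk
      _ = _ := by ring
  · rw [Nat.div_add_mod', Nat.div_add_mod', Nat.div_add_mod']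

/-! ### Correctness of the test program -/

namespace Access.Represents

open Term Finset

open scoped Classical

variable {A : Access} {V W : Type} [Fintype V] [Fintype W] {R : Net V W} {w : List ℕ}
  {cV : V → ℕ × ℕ} {cW : W → ℕ × ℕ}

/-- The code of a pair of nodes. -/
def code (cV : V → ℕ × ℕ) (l : ℕ) (v v' : V) : ℕ :=
  (((cV v).1 * l + (cV v).2) * l + (cV v').1) * l + (cV v').2

/-- The contents of the tape. -/
noncomputable def table (R : Net V W) (cV : V → ℕ × ℕ) (l p : ℕ) : ℕ :=
  ∑ v, ∑ v', if p % l ^ 4 = code cV l v v' then R.pairs (p / l ^ 4) v v' else 0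

omit [Fintype V] [Fintype W] in
theorem code_lt (h : A.Represents R w cV cW) (v v' : V) :
    code cV w.length v v' < w.length ^ 4 :=
  digit_lt (digit_lt (digit_lt (by simpa using (h.node_lt v).1) (h.node_lt v).2)
    (h.node_lt v').1) (h.node_lt v').2

theorem table_eq {l k x : ℕ} (hx : x < l ^ 4) : table R cV l (k * l ^ 4 + x) =
    ∑ v, ∑ v', if x = code cV l v v' then R.pairs k v v' else 0 := by
  have h₁ : (k * l ^ 4 + x) % l ^ 4 = x := by
    rw [Nat.mul_comm, Nat.mul_add_mod, Nat.mod_eq_of_lt hx]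
  have h₂ : (k * l ^ 4 + x) / l ^ 4 = k := by
    rw [Nat.mul_comm, Nat.mul_add_div (by omega), Nat.div_eq_of_lt hx, add_zero]
  rw [table, h₁, h₂]

omit [Fintype V] [Fintype W] in
-- The digits are split off from the last one on. The leading digit `a` needs no bound, since
-- `digit_inj` only bounds the digit that it splits off.
theorem digits_eq_code_iff (h : A.Represents R w cV cW) {a b c d : ℕ} (hb : b < w.length)
    (hc : c < w.length) (hd : d < w.length) (v v' : V) :
    ((a * w.length + b) * w.length + c) * w.length + d = code cV w.length v v' ↔
      cV v = (a, b) ∧ cV v' = (c, d) := by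
  rw [code, digit_inj hd (h.node_lt v').2, digit_inj hc (h.node_lt v').1,
    digit_inj hb (h.node_lt v).2, Prod.ext_iff, Prod.ext_iff]
  simp only [eq_comm (a := a), eq_comm (a := b), eq_comm (a := c), eq_comm (a := d), and_assoc]

theorem table_code (h : A.Represents R w cV cW) (k : ℕ) (v v' : V) :
    table R cV w.length (k * w.length ^ 4 + code cV w.length v v') = R.pairs k v v' := by
  have : ∀ u u', code cV w.length v v' = code cV w.length u u' ↔ v = u ∧ v' = u' := fun u u' => by
    rw [code, h.digits_eq_code_iff (h.node_lt v).2 (h.node_lt v').1 (h.node_lt v').2]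
    exact ⟨fun ⟨h₁, h₂⟩ => ⟨(h.node_inj h₁).symm, (h.node_inj h₂).symm⟩, by
      rintro ⟨rfl, rfl⟩; exact ⟨rfl, rfl⟩⟩
  rw [table_eq (h.code_lt v v')]
  simp only [this, ite_and]
  simp

theorem tape_agrees (g : ℕ → ℕ) (p i : ℕ) (hi : i < w.length) : tape w g p i = w.getD i 0 :=
  tape_of_lt hi

/-- Both sides are `1` if the variables code two target nodes. Otherwise every summand on the right
vanishes, either because the codes do not fit or because `pairs 0` is zero. -/
theorem eval_baseTerm (h : A.Represents R w cV cW) {M : ℕ → ℕ}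
    (hM : ∀ i < w.length, M i = w.getD i 0) (ρ : ℕ → ℕ) : A.baseTerm.eval w.length M ρ =
      ∑ v, ∑ v', if cV v = (ρ 3, ρ 2) ∧ cV v' = (ρ 1, ρ 0) then R.pairs 0 v v' else 0 := by
  have h₁ := h.target M hM ρ (var 3) (var 2)
  have h₂ := h.target M hM ρ (var 1) (var 0)
  simp only [eval] at h₁ h₂
  simp only [baseTerm, eval, h₁, h₂]
  by_cases e₁ : ∃ v ∈ R.T, cV v = (ρ 3, ρ 2)
  · obtain ⟨v, hv, hcv⟩ := e₁
    by_cases e₂ : ∃ v ∈ R.T, cV v = (ρ 1, ρ 0)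
    · obtain ⟨v', hv', hcv'⟩ := e₂
      rw [if_pos ⟨v, hv, hcv⟩, if_pos ⟨v', hv', hcv'⟩]
      simp only [← hcv, ← hcv', h.node_inj.eq_iff, ite_and]
      simp [Net.pairs, hv, hv']
    · rw [if_pos ⟨v, hv, hcv⟩, if_neg e₂]
      refine (sum_eq_zero fun u _ => sum_eq_zero fun u' _ => ?_).symm
      split_ifs with hu
      · exact if_neg fun hT => e₂ ⟨u', hT.2, hu.2⟩
      · rfl
  · rw [if_neg e₁]
    refine (sum_eq_zero fun u _ => sum_eq_zero fun u' _ => ?_).symm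
    split_ifs with hu
    · exact if_neg fun hT => e₁ ⟨u, hT.1, hu.1⟩
    · rfl

omit [Fintype V] [Fintype W] in
-- Subtracting `l ^ 4` from an address, for `l` the length of `w`, moves to the preceding block of
-- the table. The cell that is read thus belongs to walks shorter by one, from the end nodes of the
-- two edges.
theorem eval_edgePairTerm (h : A.Represents R w cV cW) {M : ℕ → ℕ}
    (hM : ∀ i < w.length, M i = w.getD i 0) {ρ : ℕ → ℕ} {f f' : W} (hf : cW f = (ρ 8, ρ 9))
    (hf' : cW f' = (ρ 10, ρ 11)) : A.edgePairTerm.eval w.length M ρ =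
      if R.edgeId f = R.edgeId f' ∧ cV (R.src f) = (ρ 3, ρ 2) ∧ cV (R.src f') = (ρ 1, ρ 0) then
        M (w.length + ((((ρ 7 * w.length + ρ 6) * w.length + ρ 5) * w.length + ρ 4) *
          w.length ^ 4 + code cV w.length (R.tgt f) (R.tgt f')) - w.length ^ 4) else 0 := by
  -- The access terms occur below the sums of `mulLen`, so their values are needed for every content
  -- of the variable `12`.
  have hs : ∀ j, A.EdgeSpec R cV w.length M (Function.update ρ 12 j) (var 8) (var 9) f :=
    fun j => h.edge M hM _ _ _ _ (by simpa [eval] using hf)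
  have hs' : ∀ j, A.EdgeSpec R cV w.length M (Function.update ρ 12 j) (var 10) (var 11) f' :=
    fun j => h.edge M hM _ _ _ _ (by simpa [eval] using hf')
  have h₁ : A.EdgeSpec R cV w.length M ρ (var 8) (var 9) f := by simpa using hs (ρ 12)
  have h₂ : A.EdgeSpec R cV w.length M ρ (var 10) (var 11) f' := by simpa using hs' (ρ 12)
  have ha := (HasValue.address (fun j => (hs j).tgtFst) (fun j => (hs j).tgtSnd)
    (fun j => (hs' j).tgtFst) (fun j => (hs' j).tgtSnd)).eval_eq
  have h1 : HasValue w.length M ρ (const 1) 1 := fun _ => rfl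
  have hb := h1.mulLen.mulLen.mulLen.mulLen.eval_eq
  have hb' : 1 * w.length * w.length * w.length * w.length = w.length ^ 4 := by ring
  simp only [edgePairTerm, eval, h₁.edge, h₂.edge, eval_ifEq, h₁.edgeId, h₂.edgeId, h₁.srcFst,
    h₁.srcSnd, h₂.srcFst, h₂.srcSnd, ha, hb, hb', ne_eq, not_false_eq_true, if_true, Prod.ext_iff,
    ite_and, code]

/-- Combinations that code no edges contribute `0`, so the four sums range over pairs of edges. The
entries that are read lie in block `k`, which is complete by `hp`. -/
theorem eval_stepTerm (h : A.Represents R w cV cW) {k p : ℕ} {ρ : ℕ → ℕ}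
    (hk : ((ρ 7 * w.length + ρ 6) * w.length + ρ 5) * w.length + ρ 4 = k + 1)
    (hp : (k + 1) * w.length ^ 4 ≤ p) :
    A.stepTerm.eval w.length (tape w (table R cV w.length) p) ρ =
      ∑ v, ∑ v', if cV v = (ρ 3, ρ 2) ∧ cV v' = (ρ 1, ρ 0) then R.pairs (k + 1) v v' else 0 := by
  have hM := tape_agrees (w := w) (table R cV w.length) p
  have key : A.stepTerm.eval w.length (tape w (table R cV w.length) p) ρ = ∑ f, ∑ f',
      if R.edgeId f = R.edgeId f' ∧ cV (R.src f) = (ρ 3, ρ 2) ∧ cV (R.src f') = (ρ 1, ρ 0) then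
        R.pairs k (R.tgt f) (R.tgt f') else 0 := by
    simp only [stepTerm, eval]
    refine sum_range_range_eq_sum h.edge_inj h.edge_lt _ _ (fun f => ?_) (fun a b hab => ?_)
    · refine sum_range_range_eq_sum h.edge_inj h.edge_lt _ _ (fun f' => ?_) (fun a b hab => ?_)
      · rw [h.eval_edgePairTerm hM (f := f) (f' := f') (by simp) (by simp)]
        simp only [ne_eq, Nat.reduceEqDiff, not_false_eq_true,
          Function.update_of_ne, hk, OfNat.zero_ne_ofNat, OfNat.one_ne_ofNat]
        have hc := h.code_lt (R.tgt f) (R.tgt f')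
        have e : w.length + ((k + 1) * w.length ^ 4 + code cV w.length (R.tgt f) (R.tgt f')) -
            w.length ^ 4 =
            w.length + (k * w.length ^ 4 + code cV w.length (R.tgt f) (R.tgt f')) := by
          rw [Nat.add_mul]; omega
        rw [e, tape_length_add (by rw [Nat.add_mul] at hp; omega), h.table_code]
      · have : ¬ (A.edge (var 10) (var 11)).eval w.length (tape w (table R cV w.length) p)
            (Function.update (Function.update (Function.update (Function.update ρ 8 (cW f).1) 9
              (cW f).2) 10 a) 11 b) ≠ 0 := fun hne => by
          obtain ⟨f', hf'⟩ := h.exists_edge _ hM _ _ _ hne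
          exact hab f' (by simpa [eval] using hf')
        simp only [edgePairTerm, eval, if_neg this, ite_self]
    · refine sum_eq_zero fun a' _ => sum_eq_zero fun b' _ => ?_
      have : ¬ (A.edge (var 8) (var 9)).eval w.length (tape w (table R cV w.length) p)
          (Function.update (Function.update (Function.update (Function.update ρ 8 a) 9
            b) 10 a') 11 b') ≠ 0 := fun hne => by
        obtain ⟨f, hf⟩ := h.exists_edge _ hM _ _ _ hne
        exact hab f (by simpa [eval] using hf)
      simp only [edgePairTerm, eval, if_neg this]
  rw [key]
  simp only [Net.pairs]
  -- With the conditions moved below the sums over edges, the sums over `v` and `v'` collapse, as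
  -- each edge has just one source.
  have hsum : ∀ v v', (if cV v = (ρ 3, ρ 2) ∧ cV v' = (ρ 1, ρ 0) then
      (∑ f, ∑ f', if R.src f = v ∧ R.src f' = v' ∧ R.edgeId f = R.edgeId f' then
        R.pairs k (R.tgt f) (R.tgt f') else 0) else 0) =
      ∑ f, ∑ f', if R.src f = v then if R.src f' = v' then
        (if R.edgeId f = R.edgeId f' ∧ cV (R.src f) = (ρ 3, ρ 2) ∧ cV (R.src f') = (ρ 1, ρ 0) then
        R.pairs k (R.tgt f) (R.tgt f') else 0) else 0 else 0 := by
    intro v v'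
    by_cases hv : cV v = (ρ 3, ρ 2) ∧ cV v' = (ρ 1, ρ 0)
    · rw [if_pos hv]
      refine sum_congr rfl fun f _ => sum_congr rfl fun f' _ => ?_
      by_cases h₁ : R.src f = v
      · by_cases h₂ : R.src f' = v'
        · simp only [h₁, h₂, hv, true_and, and_self, and_true, if_true]
        · simp [h₂]
      · simp [h₁]
    · rw [if_neg hv]
      refine (sum_eq_zero fun f _ => sum_eq_zero fun f' _ => ?_).symm
      split_ifs with h₁ h₂ h₃
      · exact absurd (h₁ ▸ h₂ ▸ h₃.2) hv
      all_goals rfl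
  simp only [hsum]
  simp_rw [sum_comm (s := (univ : Finset V)) (t := (univ : Finset W))]
  simp

/-- The digits `7` to `4` form the walk length and the digits `3` to `0` the two nodes. Block `0` is
the base case; every later block is computed from the one before it. -/
theorem eval_pairsTerm (h : A.Represents R w cV cW) {ρ : ℕ → ℕ} (hρ : ∀ i < 8, ρ i < w.length) :
    A.pairsTerm.eval w.length
      (tape w (table R cV w.length) (∑ i ∈ range 8, ρ i * w.length ^ i)) ρ =
      table R cV w.length (∑ i ∈ range 8, ρ i * w.length ^ i) := by
  have hpos : ∑ i ∈ range 8, ρ i * w.length ^ i =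
      (((ρ 7 * w.length + ρ 6) * w.length + ρ 5) * w.length + ρ 4) * w.length ^ 4 +
      (((ρ 3 * w.length + ρ 2) * w.length + ρ 1) * w.length + ρ 0) := by
    simp only [sum_range_succ, range_zero, sum_empty]; ring
  rw [hpos, table_eq (digit_lt (digit_lt (digit_lt (by simpa using hρ 3 (by norm_num))
    (hρ 2 (by norm_num))) (hρ 1 (by norm_num))) (hρ 0 (by norm_num)))]
  simp only [h.digits_eq_code_iff (hρ 2 (by norm_num)) (hρ 1 (by norm_num)) (hρ 0 (by norm_num))]
  have hl : 0 < w.length := (Nat.zero_le _).trans_lt (hρ 0 (by norm_num))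
  rcases hk : ((ρ 7 * w.length + ρ 6) * w.length + ρ 5) * w.length + ρ 4 with _ | k
  -- In a positive base a number is zero if and only if the sum of its digits is, which is the test
  -- made by `pairsTerm`.
  · have h0 : ρ 7 + ρ 6 + (ρ 5 + ρ 4) = 0 := by
      simp only [Nat.add_eq_zero_iff, Nat.mul_eq_zero, hl.ne', or_false] at hk ⊢
      tauto
    simp only [pairsTerm, eval, h0, ne_eq, not_true_eq_false, if_false]
    exact h.eval_baseTerm (tape_agrees _ _) ρ
  · have h0 : ρ 7 + ρ 6 + (ρ 5 + ρ 4) ≠ 0 := by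
      intro h0
      simp only [Nat.add_eq_zero_iff] at h0
      simp [h0] at hk
    simp only [pairsTerm, eval, h0, ne_eq, not_false_eq_true, if_true]
    exact h.eval_stepTerm hk (by omega)

omit [Fintype W] in
theorem eval_sourcePairs (h : A.Represents R w cV cW) {M : ℕ → ℕ}
    (hM : ∀ i < w.length, M i = w.getD i 0) (ρ : ℕ → ℕ) (t : Term) (G : V → V → ℕ)
    (hG : ∀ v v', t.eval w.length M (Function.update (Function.update (Function.update
      (Function.update ρ 3 (cV v).1) 2 (cV v).2) 1 (cV v').1) 0 (cV v').2) = G v v') :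
    (A.sourcePairs t).eval w.length M ρ = ∑ v, ∑ v',
      if v ∈ R.S ∧ v' ∈ R.S ∧ R.nodeId v = R.nodeId v' then G v v' else 0 := by
  simp only [sourcePairs, eval]
  refine sum_range_range_eq_sum h.node_inj h.node_lt _ _ (fun v => ?_) (fun a b hab => ?_)
  · refine sum_range_range_eq_sum h.node_inj h.node_lt _ _ (fun v' => ?_) (fun a b hab => ?_)
    · set σ := Function.update (Function.update (Function.update
        (Function.update ρ 3 (cV v).1) 2 (cV v).2) 1 (cV v').1) 0 (cV v').2 with hσ
      have c₁ : cV v = ((var 3).eval w.length M σ, (var 2).eval w.length M σ) := by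
        simp [eval, hσ]
      have c₂ : cV v' = ((var 1).eval w.length M σ, (var 0).eval w.length M σ) := by
        simp [eval, hσ]
      have h₁ := h.source M hM σ (var 3) (var 2)
      have h₂ := h.source M hM σ (var 1) (var 0)
      rw [← c₁] at h₁
      rw [← c₂] at h₂
      simp only [h.node_inj.eq_iff, exists_eq_right] at h₁ h₂
      simp only [h₁, h₂, eval_ifEq, h.nodeId M hM σ _ _ v c₁, h.nodeId M hM σ _ _ v' c₂,
        ite_and, show t.eval w.length M σ = G v v' from hG v v']
    · set σ := Function.update (Function.update (Function.update
        (Function.update ρ 3 (cV v).1) 2 (cV v).2) 1 a) 0 b with hσ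
      have : ¬ (A.source (var 1) (var 0)).eval w.length M σ ≠ 0 := fun hne => by
        obtain ⟨u, -, hu⟩ := (h.source M hM σ _ _).mp hne
        exact hab u (by simpa [eval, hσ] using hu)
      simp only [if_neg this, ite_self]
  · refine sum_eq_zero fun a' _ => sum_eq_zero fun b' _ => ?_
    set σ := Function.update (Function.update (Function.update
      (Function.update ρ 3 a) 2 b) 1 a') 0 b' with hσ
    have : ¬ (A.source (var 3) (var 2)).eval w.length M σ ≠ 0 := fun hne => by
      obtain ⟨u, -, hu⟩ := (h.source M hM σ _ _).mp hne
      exact hab u (by simpa [eval, hσ] using hu)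
    simp only [if_neg this]

theorem eval_excessTerm (h : A.Represents R w cV cW) {ρ : ℕ → ℕ}
    (hρ : ∀ i < 8, 4 ≤ i → ρ i < w.length) :
    A.excessTerm.eval w.length (tape w (table R cV w.length) (w.length ^ 8)) ρ =
      R.same (((ρ 7 * w.length + ρ 6) * w.length + ρ 5) * w.length + ρ 4) -
      R.opposite (((ρ 7 * w.length + ρ 6) * w.length + ρ 5) * w.length + ρ 4) := by
  have hM := tape_agrees (w := w) (table R cV w.length) (w.length ^ 8)
  set k := ((ρ 7 * w.length + ρ 6) * w.length + ρ 5) * w.length + ρ 4 with hk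
  have hkl : k < w.length ^ 4 := digit_lt (digit_lt (digit_lt
    (by simpa using hρ 7 (by norm_num) (by norm_num)) (hρ 6 (by norm_num) (by norm_num)))
    (hρ 5 (by norm_num) (by norm_num))) (hρ 4 (by norm_num) (by norm_num))
  clear_value k
  have hcell : ∀ v v', (cell (address (var 3) (var 2) (var 1) (var 0))).eval w.length
      (tape w (table R cV w.length) (w.length ^ 8)) (Function.update (Function.update
        (Function.update (Function.update ρ 3 (cV v).1) 2 (cV v).2) 1 (cV v').1) 0 (cV v').2) =
      R.pairs k v v' := by
    intro v v'
    rw [eval, (HasValue.address (.var (by norm_num)) (.var (by norm_num)) (.var (by norm_num))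
      (.var (by norm_num))).eval_eq]
    simp only [ne_eq, Nat.reduceEqDiff, not_false_eq_true,
      Function.update_of_ne, OfNat.ofNat_ne_zero, OfNat.ofNat_ne_one, Function.update_self,
      one_ne_zero]
    rw [← hk, tape_length_add, ← code, h.table_code]
    rw [← code]
    have := h.code_lt v v'
    -- The entry lies within the `w.length ^ 8` tabulated ones because `k < w.length ^ 4`.
    calc k * w.length ^ 4 + code cV w.length v v' < (k + 1) * w.length ^ 4 := by
          rw [Nat.succ_mul]; omega
      _ ≤ w.length ^ 4 * w.length ^ 4 := by gcongr; omega
      _ = w.length ^ 8 := by ring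
  have hside : ∀ v v', ((A.side (var 3) (var 2)).eval w.length
      (tape w (table R cV w.length) (w.length ^ 8)) (Function.update (Function.update
        (Function.update (Function.update ρ 3 (cV v).1) 2 (cV v).2) 1 (cV v').1) 0 (cV v').2) =
      (A.side (var 1) (var 0)).eval w.length
      (tape w (table R cV w.length) (w.length ^ 8)) (Function.update (Function.update
        (Function.update (Function.update ρ 3 (cV v).1) 2 (cV v).2) 1 (cV v').1) 0 (cV v').2)) ↔
      R.side v = R.side v' := by
    intro v v'
    rw [h.side _ hM _ _ _ v (by simp [eval]), h.side _ hM _ _ _ v' (by simp [eval])]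
    cases R.side v <;> cases R.side v' <;> simp
  rw [excessTerm, eval, h.eval_sourcePairs hM ρ _
      (fun v v' => if R.side v = R.side v' then R.pairs k v v' else 0)
      (fun v v' => by simp only [eval_ifEq, hcell, hside]),
    h.eval_sourcePairs hM ρ _
      (fun v v' => if R.side v ≠ R.side v' then R.pairs k v v' else 0)
      (fun v v' => by simp only [eval_ifNe, hcell, hside, ne_eq])]
  simp only [Net.same, Net.opposite, ite_and]

/-- By truncated subtraction an excess is zero if and only if `same k ≤ opposite k`. Excesses cannot
cancel, so their sum is zero if and only if each of them is; the four digits run through all `k`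
below `w.length ^ 4`. -/
theorem resultTerm_eval (h : A.Represents R w cV cW) (ρ : ℕ → ℕ) :
    A.resultTerm.eval w.length (tape w (table R cV w.length) (w.length ^ 8)) ρ =
      if ∀ k < w.length ^ 4, R.same k ≤ R.opposite k then 1 else 0 := by
  have hex : ∀ a < w.length, ∀ b < w.length, ∀ c < w.length, ∀ d < w.length,
      A.excessTerm.eval w.length (tape w (table R cV w.length) (w.length ^ 8))
        (Function.update (Function.update (Function.update
          (Function.update ρ 7 a) 6 b) 5 c) 4 d) =
      R.same (((a * w.length + b) * w.length + c) * w.length + d) -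
      R.opposite (((a * w.length + b) * w.length + c) * w.length + d) := by
    intro a ha b hb c hc d hd
    rw [h.eval_excessTerm]
    · simp
    · intro i hi hi'
      interval_cases i <;> simp [ha, hb, hc, hd]
  simp only [resultTerm, eval]
  split_ifs with hall
  · rw [sum_eq_zero, Nat.sub_zero]
    refine fun a ha => sum_eq_zero fun b hb => sum_eq_zero fun c hc => sum_eq_zero fun d hd => ?_
    rw [mem_range] at ha hb hc hd
    rw [hex a ha b hb c hc d hd]
    exact Nat.sub_eq_zero_of_le (hall _ (digit_lt (digit_lt (digit_lt (by simpa using ha) hb) hc)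
      hd))
  · refine Nat.sub_eq_zero_of_le (Nat.one_le_iff_ne_zero.mpr fun hsum => hall fun k hk => ?_)
    obtain ⟨a, ha, b, hb, c, hc, d, hd, rfl⟩ := exists_digits hk
    simp only [sum_eq_zero_iff, mem_range] at hsum
    have := hsum a ha b hb c hc d hd
    rw [hex a ha b hb c hc d hd] at this
    omega

/-- The program decides in polynomial time whether all signed numbers of walks vanish. -/
theorem program_testsWithin (h : A.Represents R w cV cW) {P : Prop}
    (hP : P ↔ ∀ a l, R.signedCount a l = 0) :
    A.program.TestsWithin w P (A.time.eval w.length) := by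
  -- Codes are injective pairs of numbers below `w.length`. Hence `|V| ^ 2 ≤ w.length ^ 4`, and the
  -- tabulated lengths reach the Cayley–Hamilton bound.
  have hcard : Fintype.card V ≤ w.length * w.length := by
    rw [← Fintype.card_fin w.length, ← Fintype.card_prod]
    refine Fintype.card_le_of_injective
      (fun v => ((⟨_, (h.node_lt v).1⟩, ⟨_, (h.node_lt v).2⟩) : Fin _ × Fin _)) fun v v' hv => ?_
    simp only [Prod.mk.injEq, Fin.mk.injEq] at hv
    exact h.node_inj (Prod.ext hv.1 hv.2)
  have hK : Fintype.card V * Fintype.card V ≤ w.length ^ 4 :=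
    (Nat.mul_le_mul hcard hcard).trans_eq (by ring)
  rw [← R.same_le_opposite_iff hK] at hP
  refine fillAndReturn_testsWithin _ _ _ w (table R cV w.length) P
    (fun ρ hρ => h.eval_pairsTerm hρ) (fun ρ hp => ?_) (fun ρ hp => ?_)
  · rw [h.resultTerm_eval, if_pos (hP.mp hp)]
  · rw [h.resultTerm_eval, if_neg (fun hk => hp (hP.mpr hk))]

end Access.Represents

end RAM

/-! ## Path multiset representations and nets -/

namespace PathSeq

variable {N E N' E' : Type*}

theorem tgt_cons (v : N) (e : E) (u : N) (l : List (E × N)) :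
    (⟨v, (e, u) :: l⟩ : PathSeq N E).tgt = (⟨u, l⟩ : PathSeq N E).tgt := by
  simp [tgt, nodes]

theorem tgt_map (f : N → N') (g : E → E') (ρ : PathSeq N E) : (ρ.map f g).tgt = f ρ.tgt := by
  obtain ⟨v, l⟩ := ρ
  induction l generalizing v with
  | nil => rfl
  | cons p l ih => exact (tgt_cons _ _ _ _).trans ((ih p.2).trans (congrArg f (tgt_cons _ _ _ _).symm))

end PathSeq

/-- An edge determines its end node, so the start and the edges determine all nodes. -/
theorem UGraph.IsWalkFrom.eq_of_edges_eq {N E : Type*} {H : UGraph N E} {v : N}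
    {l l' : List (E × N)} (h : H.IsWalkFrom v l) (h' : H.IsWalkFrom v l')
    (he : l.map Prod.fst = l'.map Prod.fst) : l = l' := by
  induction l generalizing v l' with
  | nil => exact (List.map_eq_nil_iff.mp he.symm).symm
  | cons p l ih =>
    obtain _ | ⟨p', l'⟩ := l'
    · simp at he
    · obtain ⟨e, u⟩ := p
      obtain ⟨e', u'⟩ := p'
      simp only [List.map_cons, List.cons.injEq] at he
      obtain ⟨rfl, he⟩ := he
      obtain ⟨h₁, h₂⟩ := h
      obtain ⟨h₁', h₂'⟩ := h'
      obtain rfl : u = u' := (Prod.ext_iff.mp (h₁.symm.trans h₁')).2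
      rw [ih h₂ h₂' he]

theorem UGraph.IsPath.eq_of_edges_eq {N E : Type*} {H : UGraph N E} {π π' : PathSeq N E}
    (h : H.IsPath π) (h' : H.IsPath π') (hs : π.src = π'.src) (he : π.edges = π'.edges) :
    π = π' := by
  obtain ⟨v, l⟩ := π
  obtain ⟨v', l'⟩ := π'
  obtain rfl : v = v' := hs
  exact congrArg (PathSeq.mk v) (UGraph.IsWalkFrom.eq_of_edges_eq h h' he)

/-- Graph homomorphisms map walks to walks. -/
theorem UGraph.IsWalkFrom.map {N E N' E' : Type*} {H : UGraph N E} {H' : UGraph N' E'} {f : N → N'}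
    {g : E → E'} (hom : ∀ e, H'.η (g e) = (f (H.η e).1, f (H.η e).2)) {v : N} {l : List (E × N)}
    (h : H.IsWalkFrom v l) : H'.IsWalkFrom (f v) (l.map (Prod.map g f)) := by
  induction l generalizing v with
  | nil => trivial
  | cons p l ih => exact ⟨by rw [hom, h.1], ih h.2⟩

/-! ### Unambiguous PMRs and trimming -/

namespace PMR

variable {N E L : Type*} {V W : Type} {G : GraphDB N E L}

/-- Distinct paths from source to target nodes represent distinct paths. -/
def Unambiguous (R : PMR G V W) : Prop :=
  ∀ ρ ρ', R.IsSTPath ρ → R.IsSTPath ρ' → ρ.map R.γN R.γE = ρ'.map R.γN R.γE → ρ = ρ'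

theorem isPath_map (R : PMR G V W) {ρ : PathSeq V W} (h : R.IsPath ρ) :
    G.IsPath (ρ.map R.γN R.γE) :=
  UGraph.IsWalkFrom.map R.hom h

theorem map_trim (R : PMR G V W) (ρ : PathSeq {v // R.UsefulNode v} {e // R.UsefulEdge e}) :
    (ρ.map Subtype.val Subtype.val).map R.γN R.γE = ρ.map R.trim.γN R.trim.γE := by
  simp only [PathSeq.map, List.map_map]
  rfl

theorem isSTPath_of_trim (R : PMR G V W) {ρ} (h : R.trim.IsSTPath ρ) :
    R.IsSTPath (ρ.map Subtype.val Subtype.val) :=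
  ⟨UGraph.IsWalkFrom.map (H := R.trim.toUGraph) (H' := R.toUGraph) (f := Subtype.val)
    (g := Subtype.val) (fun _ => rfl) h.1, h.2.1, by rw [PathSeq.tgt_map]; exact h.2.2⟩

theorem exists_isWalkFrom_trim (R : PMR G V W) (l : List (W × V)) (v : {v // R.UsefulNode v})
    (h : R.IsWalkFrom v.1 l) (hn : ∀ u ∈ l.map Prod.snd, R.UsefulNode u)
    (he : ∀ e ∈ l.map Prod.fst, R.UsefulEdge e) :
    ∃ l', R.trim.IsWalkFrom v l' ∧ l'.map (Prod.map Subtype.val Subtype.val) = l := by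
  induction l generalizing v with
  | nil => exact ⟨[], trivial, rfl⟩
  | cons p l ih =>
    simp only [List.map_cons, List.forall_mem_cons] at hn he
    obtain ⟨l', h₁, h₂⟩ := ih ⟨p.2, hn.1⟩ h.2 hn.2 he.2
    refine ⟨(⟨p.1, he.1⟩, ⟨p.2, hn.1⟩) :: l', ⟨Prod.ext ?_ ?_, h₁⟩, by simp [h₂]⟩
    · exact Subtype.ext (Prod.ext_iff.mp h.1).1
    · exact Subtype.ext (Prod.ext_iff.mp h.1).2

/-- A path from `S` to `T` itself witnesses that its nodes and edges are useful, so it survives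
trimming. -/
theorem spaths_trim (R : PMR G V W) : R.trim.spaths = R.spaths := by
  ext π
  constructor
  · rintro ⟨ρ, hρ, rfl⟩
    exact ⟨_, R.isSTPath_of_trim hρ, R.map_trim ρ⟩
  · rintro ⟨ρ, hρ, rfl⟩
    obtain ⟨l', h₁, h₂⟩ := R.exists_isWalkFrom_trim ρ.steps
      ⟨ρ.src, ρ, hρ, List.mem_cons_self⟩ hρ.1
      (fun u hu => ⟨ρ, hρ, List.mem_cons_of_mem _ hu⟩) (fun e he => ⟨ρ, hρ, he⟩)
    set ρ' : PathSeq {v // R.UsefulNode v} {e // R.UsefulEdge e} :=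
      ⟨⟨ρ.src, ρ, hρ, List.mem_cons_self⟩, l'⟩
    have h₃ : ρ'.map Subtype.val Subtype.val = ρ := by
      simp only [PathSeq.map, ρ', h₂]
    refine ⟨ρ', ⟨h₁, hρ.2.1, ?_⟩, ?_⟩
    · have := hρ.2.2
      rw [← h₃, PathSeq.tgt_map] at this
      exact this
    · rw [← map_trim, h₃]

theorem Unambiguous.trim {R : PMR G V W} (h : R.Unambiguous) : R.trim.Unambiguous := by
  intro ρ ρ' hρ hρ' e
  have := h _ _ (R.isSTPath_of_trim hρ) (R.isSTPath_of_trim hρ')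
    (by rwa [map_trim, map_trim])
  obtain ⟨v, l⟩ := ρ
  obtain ⟨v', l'⟩ := ρ'
  simp only [PathSeq.map, PathSeq.mk.injEq] at this ⊢
  exact ⟨Subtype.ext this.1,
    (Function.Injective.prodMap Subtype.val_injective Subtype.val_injective).list_map this.2⟩

end PMR

/-- The states of a run after the first one. -/
def NFA.Path.states {L Q : Type*} {A : NFA L Q} : ∀ {s t : Q} {w : List L}, A.Path s t w → List Q
  | _, _, _, .nil _ => []
  | _, _, _, .cons t _ _ _ _ _ p => t :: p.states

/-! ### Products with unambiguous automata -/

namespace GraphDB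

variable {N E L Q : Type*} {G : GraphDB N E L} {A : NFA L Q}

/-- Project to the state components: consecutive states are joined by the transition inside the
product edge, whose label is that of the graph edge. -/
theorem exists_run_of_isWalkFrom (l : List ({p : E × A.Transition // p.2.1.2.1 = G.lab p.1} × (N × Q)))
    (v : N × Q) (h : (G.prod A).IsWalkFrom v l) :
    ∃ p : A.Path v.2 (⟨v, l⟩ : PathSeq _ _).tgt.2 (l.map fun p => G.lab p.1.1.1),
      p.states = l.map fun p => p.2.2 := by
  induction l generalizing v with
  | nil => exact ⟨.nil _, rfl⟩
  | cons p l ih =>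
    obtain ⟨⟨⟨e, d⟩, he⟩, u⟩ := p
    obtain ⟨r, hr⟩ := ih u h.2
    rw [PathSeq.tgt_cons]
    have h₁ : d.1.1 = v.2 := congrArg (fun x => x.1.2) h.1
    have h₂ : d.1.2.2 = u.2 := congrArg (fun x => x.2.2) h.1
    have hd : u.2 ∈ A.step v.2 (G.lab e) := by
      have := d.2
      rw [h₁, h₂] at this
      exact he ▸ this
    exact ⟨.cons _ _ _ _ _ hd r, congrArg (u.2 :: ·) hr⟩

/-- A product edge is a graph edge together with a transition. The transition is determined by its
label, which the graph edge prescribes, and by its two states. -/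
theorem IsWalkFrom.eq_of_map_eq {v : N × Q}
    {l l' : List ({p : E × A.Transition // p.2.1.2.1 = G.lab p.1} × (N × Q))}
    (h : (G.prod A).IsWalkFrom v l) (h' : (G.prod A).IsWalkFrom v l')
    (hm : l.map (Prod.map (G.prod A).γE (G.prod A).γN) =
      l'.map (Prod.map (G.prod A).γE (G.prod A).γN))
    (hs : (l.map fun p => p.2.2) = l'.map fun p => p.2.2) : l = l' := by
  induction l generalizing v l' with
  | nil => exact (List.map_eq_nil_iff.mp hm.symm).symm
  | cons p l ih =>
    obtain _ | ⟨p', l'⟩ := l'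
    · simp at hm
    · obtain ⟨⟨⟨e, d⟩, he⟩, u⟩ := p
      obtain ⟨⟨⟨e', d'⟩, he'⟩, u'⟩ := p'
      simp only [List.map_cons, List.cons.injEq, Prod.map, Prod.mk.injEq] at hm hs
      obtain ⟨⟨h₁, h₂⟩, hm⟩ := hm
      obtain rfl : u = u' := Prod.ext h₂ hs.1
      obtain rfl : e = e' := h₁
      obtain rfl : d = d' := by
        have a₁ : d.1.1 = v.2 := congrArg (fun x => x.1.2) h.1
        have a₂ : d.1.2.2 = u.2 := congrArg (fun x => x.2.2) h.1
        have a₁' : d'.1.1 = v.2 := congrArg (fun x => x.1.2) h'.1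
        have a₂' : d'.1.2.2 = u.2 := congrArg (fun x => x.2.2) h'.1
        exact Subtype.ext (Prod.ext (a₁.trans a₁'.symm)
          (Prod.ext (he.trans he'.symm) (a₂.trans a₂'.symm)))
      rw [ih h.2 h'.2 hm hs.2]

/-- The product with an unambiguous automaton is unambiguous. -/
theorem unambiguous_prod {N E L Q : Type} {G : GraphDB N E L} {A : NFA L Q} (hA : A.Unambiguous) :
    (G.prod A).Unambiguous := by
  rintro ⟨v, l⟩ ⟨v', l'⟩ h h' e
  simp only [PathSeq.map, PathSeq.mk.injEq] at e
  have hw : (l.map fun p => G.lab p.1.1.1) = l'.map fun p => G.lab p.1.1.1 := by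
    have := congrArg (List.map fun p => G.lab p.1) e.2
    rw [List.map_map, List.map_map] at this
    exact this
  obtain ⟨r, hr⟩ := exists_run_of_isWalkFrom l v h.1
  obtain ⟨r', hr'⟩ := exists_run_of_isWalkFrom l' v' h'.1
  -- The types of the two runs mention different words; stating the claim for arbitrary equal words
  -- allows one to be substituted for the other.
  have key : ∀ {w w' : List L} (a : A.AcceptingRun w) (a' : A.AcceptingRun w'), w = w' →
      a.first = a'.first ∧ a.run.states = a'.run.states := by
    rintro w _ a a' rfl
    obtain rfl := (hA w).elim a a'
    exact ⟨rfl, rfl⟩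
  obtain ⟨k₁, k₂⟩ := key ⟨_, _, h.2.1, h.2.2, r⟩ ⟨_, _, h'.2.1, h'.2.2, r'⟩ hw
  obtain rfl : v = v' := Prod.ext e.1 k₁
  exact congrArg (PathSeq.mk v)
    (IsWalkFrom.eq_of_map_eq h.1 h'.1 e.2 (hr.symm.trans (k₂.trans hr')))

end GraphDB

/-! ### Equality of represented sets as vanishing of signed counts -/

namespace PMR

open Finset

open scoped Classical

variable {N E L : Type*} {V W V₁ W₁ V₂ W₂ : Type} {G : GraphDB N E L}

/-- The net that is formed by two PMRs. -/
def net (R₁ : PMR G V₁ W₁) (R₂ : PMR G V₂ W₂) (ν : N → ℕ) (ε : E → ℕ) :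
    Net (V₁ ⊕ V₂) (W₁ ⊕ W₂) where
  src := Sum.map (fun f => (R₁.η f).1) fun f => (R₂.η f).1
  tgt := Sum.map (fun f => (R₁.η f).2) fun f => (R₂.η f).2
  nodeId := Sum.elim (fun v => ν (R₁.γN v)) fun v => ν (R₂.γN v)
  edgeId := Sum.elim (fun f => ε (R₁.γE f)) fun f => ε (R₂.γE f)
  S := {v | Sum.elim (· ∈ R₁.S) (· ∈ R₂.S) v}
  T := {v | Sum.elim (· ∈ R₁.T) (· ∈ R₂.T) v}
  side := Sum.isRight

/-- The number of paths from `v` to target nodes with a given sequence of edge identifiers. -/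
noncomputable def count [Fintype W] (R : PMR G V W) (ε : E → ℕ) : List ℕ → V → ℕ
  | [], v => if v ∈ R.T then 1 else 0
  | e :: l, v => ∑ f, if (R.η f).1 = v ∧ ε (R.γE f) = e then count R ε l (R.η f).2 else 0

theorem net_count_inl [Fintype W₁] [Fintype W₂] (R₁ : PMR G V₁ W₁) (R₂ : PMR G V₂ W₂) (ν : N → ℕ)
    (ε : E → ℕ) (l : List ℕ) : ∀ v, (R₁.net R₂ ν ε).count l (.inl v) = R₁.count ε l v := by
  induction l with
  | nil => intro v; by_cases h : v ∈ R₁.T <;> simp [Net.count, count, net, h]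
  | cons e l ih =>
    intro v
    simp only [Net.count, count, Fintype.sum_sum_type, ← ih]
    simp [net]

theorem net_count_inr [Fintype W₁] [Fintype W₂] (R₁ : PMR G V₁ W₁) (R₂ : PMR G V₂ W₂) (ν : N → ℕ)
    (ε : E → ℕ) (l : List ℕ) : ∀ v, (R₁.net R₂ ν ε).count l (.inr v) = R₂.count ε l v := by
  induction l with
  | nil => intro v; by_cases h : v ∈ R₂.T <;> simp [Net.count, count, net, h]
  | cons e l ih =>
    intro v
    simp only [Net.count, count, Fintype.sum_sum_type, ← ih]
    simp [net]

/-- The number of paths from source nodes with identifier `a` to target nodes with a given sequence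
of edge identifiers. -/
noncomputable def sourceCount [Fintype V] [Fintype W] (R : PMR G V W) (ν : N → ℕ) (ε : E → ℕ)
    (a : ℕ) (l : List ℕ) : ℕ :=
  ∑ v : {v // v ∈ R.S ∧ ν (R.γN v) = a}, R.count ε l v

theorem net_signedCount [Fintype V₁] [Fintype V₂] [Fintype W₁] [Fintype W₂] (R₁ : PMR G V₁ W₁)
    (R₂ : PMR G V₂ W₂) (ν : N → ℕ) (ε : E → ℕ) (a : ℕ) (l : List ℕ) :
    (R₁.net R₂ ν ε).signedCount a l =
      (R₁.sourceCount ν ε a l : ℤ) - R₂.sourceCount ν ε a l := by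
  simp only [Net.signedCount, Fintype.sum_sum_type, net_count_inl, net_count_inr, sourceCount]
  have e₁ : ∀ v, (if Sum.inl v ∈ (R₁.net R₂ ν ε).S ∧ (R₁.net R₂ ν ε).nodeId (Sum.inl v) = a then
      (if (R₁.net R₂ ν ε).side (Sum.inl v) then -1 else 1) * (R₁.count ε l v : ℤ) else 0) =
      if v ∈ R₁.S ∧ ν (R₁.γN v) = a then (R₁.count ε l v : ℤ) else 0 := fun v => by
    by_cases h : v ∈ R₁.S <;> simp [net, h]
  have e₂ : ∀ v, (if Sum.inr v ∈ (R₁.net R₂ ν ε).S ∧ (R₁.net R₂ ν ε).nodeId (Sum.inr v) = a then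
      (if (R₁.net R₂ ν ε).side (Sum.inr v) then -1 else 1) * (R₂.count ε l v : ℤ) else 0) =
      if v ∈ R₂.S ∧ ν (R₂.γN v) = a then -(R₂.count ε l v : ℤ) else 0 := fun v => by
    by_cases h : v ∈ R₂.S <;> simp [net, h]
  simp only [e₁, e₂]
  rw [sub_eq_add_neg, ← sum_filter, ← sum_filter]
  push_cast
  rw [← sum_neg_distrib]
  congr 1
  · exact sum_subtype _ (by simp) fun v => (R₁.count ε l v : ℤ)
  · exact sum_subtype _ (by simp) fun v => -(R₂.count ε l v : ℤ)

/-- The continuation `t` of a path in `v` leads to a target node and has the edge identifiers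
`l`. -/
def Continues (R : PMR G V W) (ε : E → ℕ) (v : V) (t : List (W × V)) (l : List ℕ) : Prop :=
  R.IsWalkFrom v t ∧ (⟨v, t⟩ : PathSeq V W).tgt ∈ R.T ∧ (t.map fun p => ε (R.γE p.1)) = l

theorem continues_cons {R : PMR G V W} {ε : E → ℕ} {v : V} {f : W} {u : V} {t : List (W × V)}
    {e : ℕ} {l : List ℕ} : R.Continues ε v ((f, u) :: t) (e :: l) ↔
      R.η f = (v, u) ∧ ε (R.γE f) = e ∧ R.Continues ε u t l := by
  simp only [Continues, UGraph.IsWalkFrom, PathSeq.tgt_cons, List.map_cons, List.cons.injEq]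
  tauto

/-- Induction on the word: a positive sum has a positive summand, which provides the first edge. -/
theorem count_pos_iff [Fintype W] (R : PMR G V W) (ε : E → ℕ) (l : List ℕ) : ∀ v,
    0 < R.count ε l v ↔ ∃ t, R.Continues ε v t l := by
  induction l with
  | nil =>
    intro v
    by_cases h : v ∈ R.T
    · simp only [count, h, if_true, zero_lt_one, true_iff]
      exact ⟨[], trivial, h, rfl⟩
    · simp only [count, h, if_false, lt_irrefl, false_iff]
      rintro ⟨t, -, ht, h0⟩
      obtain rfl : t = [] := by simpa using h0
      exact h ht
  | cons e l ih =>
    intro v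
    simp only [count]
    rw [Nat.pos_iff_ne_zero, Ne, sum_eq_zero_iff]
    push Not
    constructor
    · rintro ⟨f, -, hf⟩
      rw [ite_ne_right_iff] at hf
      obtain ⟨t, ht⟩ := (ih _).mp (Nat.pos_of_ne_zero hf.2)
      exact ⟨(f, (R.η f).2) :: t, continues_cons.mpr ⟨Prod.ext hf.1.1 rfl, hf.1.2, ht⟩⟩
    · rintro ⟨t, ht⟩
      obtain _ | ⟨⟨f, u⟩, t⟩ := t
      · simp [Continues] at ht
      · obtain ⟨h₁, h₂, h₃⟩ := continues_cons.mp ht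
        refine ⟨f, mem_univ _, ?_⟩
        rw [h₁, if_pos ⟨rfl, h₂⟩]
        exact ((ih _).mpr ⟨t, h₃⟩).ne'

/-- The start nodes form an arbitrary family so that the induction goes through. After the first
letter the new family is indexed by pairs of an old index and a matching first edge; prepending that
edge turns continuations of the new family into continuations of the old one, so uniqueness is
inherited. -/
theorem sum_count_le_one [Fintype W] (R : PMR G V W) (ε : E → ℕ) (l : List ℕ) :
    ∀ {J : Type} [Fintype J] (s : J → V),
      (∀ j j' t t', R.Continues ε (s j) t l → R.Continues ε (s j') t' l → j = j' ∧ t = t') →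
      ∑ j, R.count ε l (s j) ≤ 1 := by
  induction l with
  | nil =>
    intro J _ s h
    simp only [count, sum_boole]
    refine Finset.card_le_one.mpr fun j hj j' hj' => ?_
    simp only [mem_filter, mem_univ, true_and] at hj hj'
    exact (h j j' [] [] ⟨trivial, hj, rfl⟩ ⟨trivial, hj', rfl⟩).1
  | cons e l ih =>
    intro J _ s h
    have := ih (J := {p : J × W // (R.η p.2).1 = s p.1 ∧ ε (R.γE p.2) = e})
      (fun p => (R.η p.1.2).2) (by
        rintro ⟨⟨j, f⟩, h₁, h₂⟩ ⟨⟨j', f'⟩, h₁', h₂'⟩ t t' ht ht'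
        obtain ⟨rfl, k⟩ := h j j' ((f, (R.η f).2) :: t) ((f', (R.η f').2) :: t')
          (continues_cons.mpr ⟨Prod.ext h₁ rfl, h₂, ht⟩)
          (continues_cons.mpr ⟨Prod.ext h₁' rfl, h₂', ht'⟩)
        simp only [List.cons.injEq, Prod.mk.injEq] at k
        obtain ⟨⟨rfl, -⟩, rfl⟩ := k
        exact ⟨rfl, rfl⟩)
    refine le_trans (le_of_eq ?_) this
    simp only [count]
    rw [← Fintype.sum_prod_type' (f := fun j f =>
      if (R.η f).1 = s j ∧ ε (R.γE f) = e then R.count ε l (R.η f).2 else 0), ← Finset.sum_filter]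
    exact Finset.sum_subtype _ (by simp) (fun p : J × W => R.count ε l (R.η p.2).2)

/-- The start and the edges determine a path of `G`, and identifiers are injective, so a counted
walk with the identifiers of `π` is mapped to `π` itself. -/
theorem sourceCount_pos_iff [Fintype V] [Fintype W] (R : PMR G V W) (ν : N ↪ ℕ) (ε : E ↪ ℕ)
    (π : PathSeq N E) (hπ : G.IsPath π) :
    0 < R.sourceCount ν ε (ν π.src) (π.edges.map ε) ↔ π ∈ R.spaths := by
  rw [sourceCount, Nat.pos_iff_ne_zero, Ne, sum_eq_zero_iff]
  push Not
  constructor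
  · rintro ⟨⟨v, hv, hv'⟩, -, h⟩
    obtain ⟨t, h₁, h₂, h₃⟩ := (R.count_pos_iff _ _ _).mp (Nat.pos_of_ne_zero h)
    refine ⟨⟨v, t⟩, ⟨h₁, hv, h₂⟩, UGraph.IsPath.eq_of_edges_eq (R.isPath_map h₁) hπ
      (ν.injective hv') (ε.injective.list_map ?_)⟩
    rw [← h₃]
    simp [PathSeq.edges, PathSeq.map]
  · rintro ⟨ρ, hρ, rfl⟩
    refine ⟨⟨ρ.src, hρ.2.1, rfl⟩, mem_univ _, ((R.count_pos_iff _ _ _).mpr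
      ⟨ρ.steps, hρ.1, hρ.2.2, ?_⟩).ne'⟩
    simp [PathSeq.edges, PathSeq.map]

/-- Complements `sourceCount_pos_iff` for arbitrary `a` and `l`, which need not come from a path of
`G`. -/
theorem exists_of_sourceCount_pos [Fintype V] [Fintype W] (R : PMR G V W) (ν : N ↪ ℕ) (ε : E ↪ ℕ)
    {a : ℕ} {l : List ℕ} (h : 0 < R.sourceCount ν ε a l) :
    ∃ π ∈ R.spaths, a = ν π.src ∧ l = π.edges.map ε := by
  rw [sourceCount, Nat.pos_iff_ne_zero, Ne, sum_eq_zero_iff] at h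
  push Not at h
  obtain ⟨⟨v, hv, hv'⟩, -, h⟩ := h
  obtain ⟨t, h₁, h₂, h₃⟩ := (R.count_pos_iff _ _ _).mp (Nat.pos_of_ne_zero h)
  refine ⟨_, ⟨⟨v, t⟩, ⟨h₁, hv, h₂⟩, rfl⟩, hv'.symm, ?_⟩
  rw [← h₃]
  simp [PathSeq.edges, PathSeq.map]

/-- Two counted walks have the same image in `G`, hence coincide. -/
theorem Unambiguous.sourceCount_le_one [Fintype V] [Fintype W] {R : PMR G V W} (h : R.Unambiguous)
    (ν : N ↪ ℕ) (ε : E ↪ ℕ) (a : ℕ) (l : List ℕ) : R.sourceCount ν ε a l ≤ 1 := by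
  refine R.sum_count_le_one ε l _ ?_
  rintro ⟨v, hv, rfl⟩ ⟨v', hv', e⟩ t t' ⟨h₁, h₂, h₃⟩ ⟨h₁', h₂', h₃'⟩
  have := h ⟨v, t⟩ ⟨v', t'⟩ ⟨h₁, hv, h₂⟩ ⟨h₁', hv', h₂'⟩
    (UGraph.IsPath.eq_of_edges_eq (R.isPath_map h₁) (R.isPath_map h₁') (ν.injective e).symm
      (ε.injective.list_map (by
        simp only [PathSeq.edges, PathSeq.map, List.map_map]
        exact h₃.trans h₃'.symm)))
  simp only [PathSeq.mk.injEq] at this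
  exact ⟨Subtype.ext this.1, this.2⟩

theorem isPath_of_mem_spaths {R : PMR G V W} {π : PathSeq N E} (h : π ∈ R.spaths) :
    G.IsPath π := by
  obtain ⟨ρ, hρ, rfl⟩ := h
  exact R.isPath_map hρ.1

/-- Unambiguous PMRs represent the same paths if and only if all signed numbers of walks of the
net formed by them vanish. -/
theorem spaths_eq_iff [Fintype V₁] [Fintype V₂] [Fintype W₁] [Fintype W₂] {R₁ : PMR G V₁ W₁}
    {R₂ : PMR G V₂ W₂} (h₁ : R₁.Unambiguous) (h₂ : R₂.Unambiguous) (ν : N ↪ ℕ) (ε : E ↪ ℕ) :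
    R₁.spaths = R₂.spaths ↔ ∀ a l, (R₁.net R₂ ν ε).signedCount a l = 0 := by
  simp only [net_signedCount]
  constructor
  · intro h a l
    have e : 0 < R₁.sourceCount ν ε a l ↔ 0 < R₂.sourceCount ν ε a l := by
      constructor <;> intro hp
      · obtain ⟨π, hπ, rfl, rfl⟩ := R₁.exists_of_sourceCount_pos ν ε hp
        exact (R₂.sourceCount_pos_iff ν ε π (isPath_of_mem_spaths hπ)).mpr (h ▸ hπ)
      · obtain ⟨π, hπ, rfl, rfl⟩ := R₂.exists_of_sourceCount_pos ν ε hp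
        exact (R₁.sourceCount_pos_iff ν ε π (isPath_of_mem_spaths hπ)).mpr (h ▸ hπ)
    -- Two numbers that are at most `1` and positive at the same time are equal.
    have := h₁.sourceCount_le_one ν ε a l
    have := h₂.sourceCount_le_one ν ε a l
    omega
  · intro h
    have e : ∀ π, G.IsPath π → (π ∈ R₁.spaths ↔ π ∈ R₂.spaths) := fun π hπ => by
      rw [← R₁.sourceCount_pos_iff ν ε π hπ, ← R₂.sourceCount_pos_iff ν ε π hπ]
      have := h (ν π.src) (π.edges.map ε)
      omega
    ext π
    exact ⟨fun hπ => (e π (isPath_of_mem_spaths hπ)).mp hπ,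
      fun hπ => (e π (isPath_of_mem_spaths hπ)).mpr hπ⟩

end PMR

/-! ## Access to encoded objects -/

theorem bitOf_ne_zero {P : Prop} : bitOf P ≠ 0 ↔ P := by
  unfold bitOf
  split_ifs with h <;> simp [h]

namespace RAM

/-- The word `l` is stored in the memory `M` from address `b` on. -/
def StoredAt (M : ℕ → ℕ) (b : ℕ) (l : List ℕ) : Prop := ∀ i < l.length, M (b + i) = l.getD i 0

namespace StoredAt

variable {M : ℕ → ℕ} {b : ℕ}

theorem left {l l' : List ℕ} (h : StoredAt M b (l ++ l')) : StoredAt M b l := fun i hi => by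
  rw [h i (by simp; omega), List.getD_append _ _ _ _ hi]

theorem right {l l' : List ℕ} (h : StoredAt M b (l ++ l')) : StoredAt M (b + l.length) l' :=
  fun i hi => by
    rw [add_assoc, h _ (by simp; omega), List.getD_append_right _ _ _ _ (by omega),
      Nat.add_sub_cancel_left]

theorem head {x : ℕ} {l : List ℕ} (h : StoredAt M b (x :: l)) : M b = x := by
  simpa using h 0 (by simp)

theorem tail {x : ℕ} {l : List ℕ} (h : StoredAt M b (x :: l)) : StoredAt M (b + 1) l :=
  StoredAt.right (l := [x]) h

theorem flatten_ofFn {n : ℕ} {f : Fin n → List ℕ} {c : ℕ} (hc : ∀ i, (f i).length = c)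
    (h : StoredAt M b (List.ofFn f).flatten) (i : Fin n) : StoredAt M (b + c * i) (f i) := by
  induction n generalizing b with
  | zero => exact i.elim0
  | succ n ih =>
    rw [List.ofFn_succ, List.flatten_cons] at h
    refine Fin.cases ?_ (fun j => ?_) i
    · simpa using h.left
    · have := ih (fun i => hc i.succ) h.right j
      rwa [hc, add_assoc, show c + c * (j : ℕ) = c * (j.succ : ℕ) by rw [Fin.val_succ]; ring]
        at this

end StoredAt

theorem length_flatten_ofFn {n : ℕ} {f : Fin n → List ℕ} {c : ℕ} (hc : ∀ i, (f i).length = c) :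
    (List.ofFn f).flatten.length = n * c := by
  induction n with
  | zero => simp
  | succ n ih =>
    rw [List.ofFn_succ, List.flatten_cons, List.length_append, hc, ih fun i => hc i.succ]
    ring

end RAM

open RAM

section Encodings

variable {N E L V W Q : Type*} {G : GraphDB N E L} {M : ℕ → ℕ} {b : ℕ}

theorem PMR.length_encode (R : PMR G V W) (ν : N ↪ ℕ) (ε : E ↪ ℕ) {n m : ℕ} (v : Fin n ≃ V)
    (e : Fin m ≃ W) : (R.encode ν ε v e).length = 2 + 3 * n + 3 * m := by
  simp only [PMR.encode, List.length_cons, List.length_append]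
  rw [length_flatten_ofFn (c := 3) fun _ => rfl, length_flatten_ofFn (c := 3) fun _ => rfl]
  ring

/-- The contents of a memory in which a PMR is stored. -/
structure PMR.Stored (R : PMR G V W) (ν : N ↪ ℕ) (ε : E ↪ ℕ) {n m : ℕ} (v : Fin n ≃ V)
    (e : Fin m ≃ W) (M : ℕ → ℕ) (b : ℕ) : Prop where
  nodes : M b = n
  edges : M (b + 1) = m
  nodeId : ∀ x a, a = b + 2 + 3 * (v.symm x : ℕ) → M a = ν (R.γN x)
  source : ∀ x a, a = b + 2 + 3 * (v.symm x : ℕ) + 1 → M a = bitOf (x ∈ R.S)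
  target : ∀ x a, a = b + 2 + 3 * (v.symm x : ℕ) + 2 → M a = bitOf (x ∈ R.T)
  edgeId : ∀ f a, a = b + 2 + 3 * n + 3 * (e.symm f : ℕ) → M a = ε (R.γE f)
  src : ∀ f a, a = b + 2 + 3 * n + 3 * (e.symm f : ℕ) + 1 → M a = v.symm (R.η f).1
  tgt : ∀ f a, a = b + 2 + 3 * n + 3 * (e.symm f : ℕ) + 2 → M a = v.symm (R.η f).2

/-- Addresses enter `PMR.Stored` through equations, so that every later use can match its own
address expression by `ring`. -/
theorem RAM.StoredAt.pmr {R : PMR G V W} {ν : N ↪ ℕ} {ε : E ↪ ℕ} {n m : ℕ} {v : Fin n ≃ V}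
    {e : Fin m ≃ W} (h : StoredAt M b (R.encode ν ε v e)) : R.Stored ν ε v e M b := by
  have hn := fun x => h.tail.tail.left.flatten_ofFn (c := 3) (fun _ => rfl) (v.symm x)
  have hr := h.tail.tail.right
  rw [length_flatten_ofFn (c := 3) fun _ => rfl] at hr
  have he := fun f => hr.flatten_ofFn (c := 3) (fun _ => rfl) (e.symm f)
  simp only [Equiv.apply_symm_apply] at hn he
  refine ⟨h.head, h.tail.head, ?_, ?_, ?_, ?_, ?_, ?_⟩
  · rintro x a rfl; exact (hn x).head
  · rintro x a rfl; exact (hn x).tail.head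
  · rintro x a rfl; exact (hn x).tail.tail.head
  · rintro f a rfl; rw [mul_comm 3 n]; exact (he f).head
  · rintro f a rfl; rw [mul_comm 3 n]; exact (he f).tail.head
  · rintro f a rfl; rw [mul_comm 3 n]; exact (he f).tail.tail.head

theorem GraphDB.length_encode (ν : N ↪ ℕ) (ε : E ↪ ℕ) (ℓ : L ↪ ℕ) {n m : ℕ} (v : Fin n ≃ N)
    (e : Fin m ≃ E) : (G.encode ν ε ℓ v e).length = 2 + n + 4 * m := by
  simp only [GraphDB.encode, List.length_cons, List.length_append, List.length_ofFn]
  rw [length_flatten_ofFn (c := 4) fun _ => rfl]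
  ring

/-- The contents of a memory in which a graph database is stored. -/
structure GraphDB.Stored (G : GraphDB N E L) (ℓ : L ↪ ℕ) {n m : ℕ} (v : Fin n ≃ N)
    (e : Fin m ≃ E) (M : ℕ → ℕ) (b : ℕ) : Prop where
  nodes : M b = n
  edges : M (b + 1) = m
  src : ∀ f a, a = b + 2 + n + 4 * (e.symm f : ℕ) + 1 → M a = v.symm (G.η f).1
  tgt : ∀ f a, a = b + 2 + n + 4 * (e.symm f : ℕ) + 2 → M a = v.symm (G.η f).2
  lab : ∀ f a, a = b + 2 + n + 4 * (e.symm f : ℕ) + 3 → M a = ℓ (G.lab f)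

theorem RAM.StoredAt.graphDB {ν : N ↪ ℕ} {ε : E ↪ ℕ} {ℓ : L ↪ ℕ} {n m : ℕ} {v : Fin n ≃ N}
    {e : Fin m ≃ E} (h : StoredAt M b (G.encode ν ε ℓ v e)) : G.Stored ℓ v e M b := by
  have hr := h.tail.tail.right
  rw [List.length_ofFn] at hr
  have he := fun f => hr.flatten_ofFn (c := 4) (fun _ => rfl) (e.symm f)
  simp only [Equiv.apply_symm_apply] at he
  refine ⟨h.head, h.tail.head, ?_, ?_, ?_⟩
  · rintro f a rfl; exact (he f).tail.head
  · rintro f a rfl; exact (he f).tail.tail.head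
  · rintro f a rfl; exact (he f).tail.tail.tail.head

theorem NFA.length_encode (A : NFA L Q) (ℓ : L ↪ ℕ) {n m : ℕ} (q : Fin n ≃ Q)
    (d : Fin m ≃ A.Transition) : (A.encode ℓ q d).length = 2 + 2 * n + 3 * m := by
  simp only [NFA.encode, List.length_cons, List.length_append]
  rw [length_flatten_ofFn (c := 2) fun _ => rfl, length_flatten_ofFn (c := 3) fun _ => rfl]
  ring

/-- The contents of a memory in which an automaton is stored. -/
structure NFA.Stored (A : NFA L Q) (ℓ : L ↪ ℕ) {n m : ℕ} (q : Fin n ≃ Q)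
    (d : Fin m ≃ A.Transition) (M : ℕ → ℕ) (b : ℕ) : Prop where
  states : M b = n
  transitions : M (b + 1) = m
  start : ∀ x a, a = b + 2 + 2 * (q.symm x : ℕ) → M a = bitOf (x ∈ A.start)
  accept : ∀ x a, a = b + 2 + 2 * (q.symm x : ℕ) + 1 → M a = bitOf (x ∈ A.accept)
  src : ∀ f a, a = b + 2 + 2 * n + 3 * (d.symm f : ℕ) → M a = q.symm f.1.1
  lab : ∀ f a, a = b + 2 + 2 * n + 3 * (d.symm f : ℕ) + 1 → M a = ℓ f.1.2.1
  tgt : ∀ f a, a = b + 2 + 2 * n + 3 * (d.symm f : ℕ) + 2 → M a = q.symm f.1.2.2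

theorem RAM.StoredAt.nfa {A : NFA L Q} {ℓ : L ↪ ℕ} {n m : ℕ} {q : Fin n ≃ Q}
    {d : Fin m ≃ A.Transition} (h : StoredAt M b (A.encode ℓ q d)) : A.Stored ℓ q d M b := by
  have hn := fun x => h.tail.tail.left.flatten_ofFn (c := 2) (fun _ => rfl) (q.symm x)
  have hr := h.tail.tail.right
  rw [length_flatten_ofFn (c := 2) fun _ => rfl] at hr
  have he := fun f => hr.flatten_ofFn (c := 3) (fun _ => rfl) (d.symm f)
  simp only [Equiv.apply_symm_apply] at hn he
  refine ⟨h.head, h.tail.head, ?_, ?_, ?_, ?_, ?_⟩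
  · rintro x a rfl; exact (hn x).head
  · rintro x a rfl; exact (hn x).tail.head
  · rintro f a rfl; rw [mul_comm 2 n]; exact (he f).head
  · rintro f a rfl; rw [mul_comm 2 n]; exact (he f).tail.head
  · rintro f a rfl; rw [mul_comm 2 n]; exact (he f).tail.tail.head

end Encodings

namespace RAM

open Term

/-! ### Access to two PMRs -/

namespace PMRPair

def triple (t : Term) : Term := add t (add t t)

/-- The address of the second PMR. -/
def base : Term := add (const 2) (add (triple (cell (const 0))) (triple (cell (const 1))))

/-- A value of `x` above `1` names no PMR; the count is then `0`, so no position lies below it. -/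
def nodeCount (x : Term) : Term :=
  ite x (ite (sub x (const 1)) (const 0) (cell base)) (cell (const 0))

def edgeCount (x : Term) : Term :=
  ite x (ite (sub x (const 1)) (const 0) (cell (add base (const 1)))) (cell (const 1))

def node (x y : Term) : Term :=
  add (ite x (add base (const 2)) (const 2)) (triple y)

def edge (x y : Term) : Term :=
  add (ite x (add base (add (const 2) (triple (cell base)))) (add (const 2) (triple (cell (const 0)))))
    (triple y)

/-- Access to two PMRs, which are stored one after the other. Nodes and edges are coded by the number
of the PMR and a position. -/
def access : Access where
  source x y := ite (sub (nodeCount x) y) (cell (add (node x y) (const 1))) (const 0)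
  target x y := ite (sub (nodeCount x) y) (cell (add (node x y) (const 2))) (const 0)
  nodeId x y := cell (node x y)
  side x _ := x
  edge x y := sub (edgeCount x) y
  edgeId x y := cell (edge x y)
  srcFst x _ := x
  srcSnd x y := cell (add (edge x y) (const 1))
  tgtFst x _ := x
  tgtSnd x y := cell (add (edge x y) (const 2))

/-- Elements of two enumerated types are coded by the number of the type and a position. -/
def code {X₁ X₂ : Type} {n₁ n₂ : ℕ} (v₁ : Fin n₁ ≃ X₁) (v₂ : Fin n₂ ≃ X₂) : X₁ ⊕ X₂ → ℕ × ℕ :=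
  Sum.elim (fun v => (0, v₁.symm v)) fun v => (1, v₂.symm v)

theorem code_injective {X₁ X₂ : Type} {n₁ n₂ : ℕ} (v₁ : Fin n₁ ≃ X₁) (v₂ : Fin n₂ ≃ X₂) :
    Function.Injective (code v₁ v₂) := by
  rintro (x | x) (y | y) h <;> simp only [code, Sum.elim_inl, Sum.elim_inr, Prod.mk.injEq,
    zero_ne_one, one_ne_zero, false_and, Fin.val_inj, true_and, EmbeddingLike.apply_eq_iff_eq] at h
  · rw [h]
  · rw [h]

theorem exists_code_eq_iff {X₁ X₂ : Type} {n₁ n₂ : ℕ} (v₁ : Fin n₁ ≃ X₁) (v₂ : Fin n₂ ≃ X₂)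
    (a b : ℕ) : (∃ v, code v₁ v₂ v = (a, b)) ↔ a = 0 ∧ b < n₁ ∨ a = 1 ∧ b < n₂ := by
  constructor
  · rintro ⟨v | v, h⟩ <;> simp only [code, Sum.elim_inl, Sum.elim_inr, Prod.mk.injEq] at h
    · exact .inl ⟨h.1.symm, h.2 ▸ Fin.is_lt _⟩
    · exact .inr ⟨h.1.symm, h.2 ▸ Fin.is_lt _⟩
  · rintro (⟨rfl, h⟩ | ⟨rfl, h⟩)
    · exact ⟨.inl (v₁ ⟨b, h⟩), by simp [code]⟩
    · exact ⟨.inr (v₂ ⟨b, h⟩), by simp [code]⟩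

variable {N E L V₁ W₁ V₂ W₂ : Type} {G : GraphDB N E L} {R₁ : PMR G V₁ W₁} {R₂ : PMR G V₂ W₂}
  {ν : N ↪ ℕ} {ε : E ↪ ℕ} {n₁ m₁ n₂ m₂ : ℕ} {v₁ : Fin n₁ ≃ V₁} {e₁ : Fin m₁ ≃ W₁}
  {v₂ : Fin n₂ ≃ V₂} {e₂ : Fin m₂ ≃ W₂} {l : ℕ} {M ρ : ℕ → ℕ}

theorem eval_triple (t : Term) : (triple t).eval l M ρ = 3 * t.eval l M ρ := by
  simp only [triple, eval]; ring

theorem eval_base (h₁ : R₁.Stored ν ε v₁ e₁ M 0) :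
    base.eval l M ρ = 2 + 3 * n₁ + 3 * m₁ := by
  have := h₁.nodes
  have := h₁.edges
  simp only [base, eval, eval_triple, zero_add] at *
  simp only [*]; ring

variable (h₁ : R₁.Stored ν ε v₁ e₁ M 0) (h₂ : R₂.Stored ν ε v₂ e₂ M (2 + 3 * n₁ + 3 * m₁))
include h₁ h₂

theorem eval_node_cell (x y : Term) (v : V₁ ⊕ V₂)
    (hv : code v₁ v₂ v = (x.eval l M ρ, y.eval l M ρ)) :
    (cell (node x y)).eval l M ρ = (R₁.net R₂ ν ε).nodeId v ∧
    (cell (add (node x y) (const 1))).eval l M ρ = bitOf (v ∈ (R₁.net R₂ ν ε).S) ∧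
    (cell (add (node x y) (const 2))).eval l M ρ = bitOf (v ∈ (R₁.net R₂ ν ε).T) := by
  obtain ⟨hx, hy⟩ := Prod.ext_iff.mp hv
  simp only at hx hy
  obtain v | v := v
  · simp only [code, Sum.elim_inl] at hx hy
    simp only [eval, node, eval_triple, ← hx, ← hy, ne_eq, not_true_eq_false, if_false]
    exact ⟨h₁.nodeId v _ (by ring), h₁.source v _ (by ring), h₁.target v _ (by ring)⟩
  · simp only [code, Sum.elim_inr] at hx hy
    simp only [eval, node, eval_triple, ← hx, ← hy, eval_base h₁, ne_eq, one_ne_zero,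
      not_false_eq_true, if_true]
    exact ⟨h₂.nodeId v _ (by ring), h₂.source v _ (by ring), h₂.target v _ (by ring)⟩

theorem eval_edge_cell (x y : Term) (f : W₁ ⊕ W₂)
    (hf : code e₁ e₂ f = (x.eval l M ρ, y.eval l M ρ)) :
    (cell (edge x y)).eval l M ρ = (R₁.net R₂ ν ε).edgeId f ∧
    (x.eval l M ρ, (cell (add (edge x y) (const 1))).eval l M ρ) =
      code v₁ v₂ ((R₁.net R₂ ν ε).src f) ∧
    (x.eval l M ρ, (cell (add (edge x y) (const 2))).eval l M ρ) =
      code v₁ v₂ ((R₁.net R₂ ν ε).tgt f) := by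
  obtain ⟨hx, hy⟩ := Prod.ext_iff.mp hf
  simp only at hx hy
  have e₁ := h₁.nodes
  have e₂ := h₂.nodes
  obtain f | f := f
  · simp only [code, Sum.elim_inl] at hx hy
    simp only [eval, edge, eval_triple, ← hx, ← hy, ne_eq, not_true_eq_false, if_false, e₁]
    exact ⟨h₁.edgeId f _ (by ring), Prod.ext rfl (h₁.src f _ (by ring)),
      Prod.ext rfl (h₁.tgt f _ (by ring))⟩
  · simp only [code, Sum.elim_inr] at hx hy
    simp only [eval, edge, eval_triple, ← hx, ← hy, eval_base h₁, ne_eq, one_ne_zero,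
      not_false_eq_true, if_true, e₂]
    exact ⟨h₂.edgeId f _ (by ring), Prod.ext rfl (h₂.src f _ (by ring)),
      Prod.ext rfl (h₂.tgt f _ (by ring))⟩

/-- Truncated subtraction serves as the comparison `y < nodeCount x`, which also rejects every `x`
above `1`. -/
theorem eval_sub_nodeCount_ne_zero (x y : Term) :
    (sub (nodeCount x) y).eval l M ρ ≠ 0 ↔
      ∃ v, code v₁ v₂ v = (x.eval l M ρ, y.eval l M ρ) := by
  have e₁ := h₁.nodes
  have e₂ := h₂.nodes
  rw [exists_code_eq_iff]
  simp only [nodeCount, eval, eval_base h₁, e₁, e₂]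
  split_ifs <;> omega

theorem eval_sub_edgeCount_ne_zero (x y : Term) :
    (sub (edgeCount x) y).eval l M ρ ≠ 0 ↔
      ∃ f, code e₁ e₂ f = (x.eval l M ρ, y.eval l M ρ) := by
  have e₁ := h₁.edges
  have e₂ := h₂.edges
  rw [zero_add] at e₁
  rw [exists_code_eq_iff]
  simp only [edgeCount, eval, eval_base h₁, e₁, e₂]
  split_ifs <;> omega

omit h₁ h₂ in
theorem represents (w : List ℕ)
    (hw : w = R₁.encode ν ε v₁ e₁ ++ R₂.encode ν ε v₂ e₂) :
    access.Represents (R₁.net R₂ ν ε) w (code v₁ v₂) (code e₁ e₂) := by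
  have hl : w.length = 2 + 3 * n₁ + 3 * m₁ + (2 + 3 * n₂ + 3 * m₂) := by
    rw [hw, List.length_append, PMR.length_encode, PMR.length_encode]
  have st : ∀ M : ℕ → ℕ, (∀ i < w.length, M i = w.getD i 0) → R₁.Stored ν ε v₁ e₁ M 0 ∧
      R₂.Stored ν ε v₂ e₂ M (2 + 3 * n₁ + 3 * m₁) := by
    intro M hM
    have h : StoredAt M 0 w := fun i hi => by rw [zero_add, hM i hi]
    rw [hw] at h
    have h' := h.right
    rw [PMR.length_encode, zero_add] at h'
    exact ⟨h.left.pmr, h'.pmr⟩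
  constructor
  · rintro (v | v)
    · have := (v₁.symm v).is_lt
      simp only [code, Sum.elim_inl]; omega
    · have := (v₂.symm v).is_lt
      simp only [code, Sum.elim_inr]; omega
  · rintro (f | f)
    · have := (e₁.symm f).is_lt
      simp only [code, Sum.elim_inl]; omega
    · have := (e₂.symm f).is_lt
      simp only [code, Sum.elim_inr]; omega
  · exact code_injective _ _
  · exact code_injective _ _
  · intro M hM ρ x y
    obtain ⟨h₁, h₂⟩ := st M hM
    have hc := eval_sub_nodeCount_ne_zero (l := w.length) (ρ := ρ) h₁ h₂ x y
    change (if (sub (nodeCount x) y).eval w.length M ρ ≠ 0 then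
      (cell (add (node x y) (const 1))).eval w.length M ρ else 0) ≠ 0 ↔ _
    by_cases hv : ∃ v, code v₁ v₂ v = (x.eval w.length M ρ, y.eval w.length M ρ)
    · rw [if_pos (hc.mpr hv)]
      obtain ⟨v, hv⟩ := hv
      rw [(eval_node_cell h₁ h₂ x y v hv).2.1, bitOf_ne_zero, ← hv]
      simp [(code_injective v₁ v₂).eq_iff]
    · rw [if_neg (mt hc.mp hv)]
      exact ⟨fun h => absurd rfl h, fun ⟨v, _, h⟩ => absurd ⟨v, h⟩ hv⟩
  · intro M hM ρ x y
    obtain ⟨h₁, h₂⟩ := st M hM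
    have hc := eval_sub_nodeCount_ne_zero (l := w.length) (ρ := ρ) h₁ h₂ x y
    change (if (sub (nodeCount x) y).eval w.length M ρ ≠ 0 then
      (cell (add (node x y) (const 2))).eval w.length M ρ else 0) ≠ 0 ↔ _
    by_cases hv : ∃ v, code v₁ v₂ v = (x.eval w.length M ρ, y.eval w.length M ρ)
    · rw [if_pos (hc.mpr hv)]
      obtain ⟨v, hv⟩ := hv
      rw [(eval_node_cell h₁ h₂ x y v hv).2.2, bitOf_ne_zero, ← hv]
      simp [(code_injective v₁ v₂).eq_iff]
    · rw [if_neg (mt hc.mp hv)]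
      exact ⟨fun h => absurd rfl h, fun ⟨v, _, h⟩ => absurd ⟨v, h⟩ hv⟩
  · intro M hM ρ x y v hv
    obtain ⟨h₁, h₂⟩ := st M hM
    exact (eval_node_cell h₁ h₂ x y v hv).1
  · intro M hM ρ x y v hv
    have := (Prod.ext_iff.mp hv).1
    simp only at this
    rw [access]
    simp only [← this]
    cases v <;> rfl
  · intro M hM ρ x y he
    obtain ⟨h₁, h₂⟩ := st M hM
    exact (eval_sub_edgeCount_ne_zero h₁ h₂ x y).mp he
  · intro M hM ρ x y f hf
    obtain ⟨h₁, h₂⟩ := st M hM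
    have h := eval_edge_cell h₁ h₂ x y f hf
    exact ⟨(eval_sub_edgeCount_ne_zero h₁ h₂ x y).mpr ⟨f, hf⟩, h.1, congrArg Prod.fst h.2.1,
      congrArg Prod.snd h.2.1, congrArg Prod.fst h.2.2, congrArg Prod.snd h.2.2⟩

end PMRPair

end RAM

namespace RAM

open Term

/-! ### Access to the products of a graph database with two automata -/

namespace ProductPair

/-- The address of the first automaton. -/
def base₁ : Term :=
  add (const 2) (add (cell (const 0)) (add (PMRPair.triple (cell (const 1))) (cell (const 1))))

/-- The address of the first transition of the first automaton. -/
def trans₁ : Term := add base₁ (add (const 2) (add (cell base₁) (cell base₁)))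

/-- The address of the second automaton. -/
def base₂ : Term := add trans₁ (PMRPair.triple (cell (add base₁ (const 1))))

/-- The address of the first transition of the second automaton. -/
def trans₂ : Term := add base₂ (add (const 2) (add (cell base₂) (cell base₂)))

/-- `t` if the position `y` is less than the value of `c`, and `u` otherwise. -/
def ifLt (y c t u : Term) : Term := ite (sub c y) t u

/-- The address of the record of a state, which has two cells. Positions from the number of states
of the first automaton on belong to the second one. -/
def state (y : Term) : Term :=
  ifLt y (cell base₁) (add (add base₁ (const 2)) (add y y))
    (add (add base₂ (const 2)) (add (sub y (cell base₁)) (sub y (cell base₁))))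

def transition (y : Term) : Term :=
  ifLt y (cell (add base₁ (const 1))) (add trans₁ (PMRPair.triple y))
    (add trans₂ (PMRPair.triple (sub y (cell (add base₁ (const 1))))))

/-- Records of graph nodes have one cell, those of graph edges four. -/
def edge (x : Term) : Term :=
  add (add (const 2) (cell (const 0))) (add (PMRPair.triple x) x)

def ifNode (x y t : Term) : Term :=
  ifLt x (cell (const 0)) (ifLt y (add (cell base₁) (cell base₂)) t (const 0)) (const 0)

def ifEdge (x y t : Term) : Term :=
  ifLt x (cell (const 1)) (ifLt y (add (cell (add base₁ (const 1))) (cell (add base₂ (const 1))))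
    t (const 0)) (const 0)

/-- The position of the state that is given by entry `i` of the transition with position `y`. -/
def endpoint (y : Term) (i : ℕ) : Term :=
  add (ifLt y (cell (add base₁ (const 1))) (const 0) (cell base₁))
    (cell (add (transition y) (const i)))

/-- Access to the products of a graph database with two automata. Nodes are coded by the position of
a node of the graph and the position of a state; edges are coded by the position of an edge of the
graph and the position of a transition. The states and the transitions of the second automaton
follow those of the first one. -/
def access : Access where
  source x y := ifNode x y (cell (state y))
  target x y := ifNode x y (cell (add (state y) (const 1)))
  nodeId x _ := x
  side _ y := ifLt y (cell base₁) (const 0) (const 1)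
  edge x y := ifEdge x y
    (ifEq (cell (add (transition y) (const 1))) (cell (add (edge x) (const 3))) (const 1))
  edgeId x _ := x
  srcFst x _ := cell (add (edge x) (const 1))
  srcSnd _ y := endpoint y 0
  tgtFst x _ := cell (add (edge x) (const 2))
  tgtSnd _ y := endpoint y 2

/-- Elements of the disjoint union of two enumerated types are coded by consecutive positions. -/
def position {X₁ X₂ : Type} {n₁ n₂ : ℕ} (v₁ : Fin n₁ ≃ X₁) (v₂ : Fin n₂ ≃ X₂) : X₁ ⊕ X₂ → ℕ :=
  Sum.elim (fun v => v₁.symm v) fun v => n₁ + v₂.symm v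

theorem position_injective {X₁ X₂ : Type} {n₁ n₂ : ℕ} (v₁ : Fin n₁ ≃ X₁) (v₂ : Fin n₂ ≃ X₂) :
    Function.Injective (position v₁ v₂) := by
  rintro (x | x) (y | y) h <;> simp only [position, Sum.elim_inl, Sum.elim_inr] at h
  · rw [v₁.symm.injective (Fin.ext h)]
  · have := (v₁.symm x).is_lt; omega
  · have := (v₁.symm y).is_lt; omega
  · rw [v₂.symm.injective (Fin.ext (Nat.add_left_cancel h))]

theorem position_lt {X₁ X₂ : Type} {n₁ n₂ : ℕ} (v₁ : Fin n₁ ≃ X₁) (v₂ : Fin n₂ ≃ X₂) (x) :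
    position v₁ v₂ x < n₁ + n₂ := by
  obtain x | x := x
  · have := (v₁.symm x).is_lt; simp only [position, Sum.elim_inl]; omega
  · have := (v₂.symm x).is_lt; simp only [position, Sum.elim_inr]; omega

theorem exists_position_eq {X₁ X₂ : Type} {n₁ n₂ : ℕ} (v₁ : Fin n₁ ≃ X₁) (v₂ : Fin n₂ ≃ X₂) {b : ℕ}
    (hb : b < n₁ + n₂) : ∃ x, position v₁ v₂ x = b := by
  by_cases h : b < n₁
  · exact ⟨.inl (v₁ ⟨b, h⟩), by simp [position]⟩
  · exact ⟨.inr (v₂ ⟨b - n₁, by omega⟩), by simp [position]; omega⟩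

variable {N E L Q₁ Q₂ : Type} {G : GraphDB N E L} {A₁ : NFA L Q₁} {A₂ : NFA L Q₂}

/-- The state of a node of one of the products. -/
def stateOf : (N × Q₁) ⊕ (N × Q₂) → Q₁ ⊕ Q₂ := Sum.map Prod.snd Prod.snd

/-- The graph node of a node of one of the products. -/
def graphNode : (N × Q₁) ⊕ (N × Q₂) → N := Sum.elim Prod.fst Prod.fst

abbrev Edges (G : GraphDB N E L) (A₁ : NFA L Q₁) (A₂ : NFA L Q₂) : Type :=
  {p : E × A₁.Transition // p.2.1.2.1 = G.lab p.1} ⊕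
    {p : E × A₂.Transition // p.2.1.2.1 = G.lab p.1}

/-- The transition of an edge of one of the products. -/
def transitionOf : Edges G A₁ A₂ → A₁.Transition ⊕ A₂.Transition :=
  Sum.map (fun p => p.1.2) fun p => p.1.2

/-- The graph edge of an edge of one of the products. -/
def graphEdge : Edges G A₁ A₂ → E := Sum.elim (fun p => p.1.1) fun p => p.1.1

variable {ν : N ↪ ℕ} {ε : E ↪ ℕ} {ℓ : L ↪ ℕ} {n m k₁ t₁ k₂ t₂ : ℕ} {v : Fin n ≃ N} {e : Fin m ≃ E}
  {q₁ : Fin k₁ ≃ Q₁} {d₁ : Fin t₁ ≃ A₁.Transition} {q₂ : Fin k₂ ≃ Q₂}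
  {d₂ : Fin t₂ ≃ A₂.Transition} {l : ℕ} {M ρ : ℕ → ℕ}

/-- The code of a node. -/
def nodeCode (v : Fin n ≃ N) (q₁ : Fin k₁ ≃ Q₁) (q₂ : Fin k₂ ≃ Q₂) (x : (N × Q₁) ⊕ (N × Q₂)) :
    ℕ × ℕ := (v.symm (graphNode x), position q₁ q₂ (stateOf x))

/-- The code of an edge. -/
def edgeCode (e : Fin m ≃ E) (d₁ : Fin t₁ ≃ A₁.Transition) (d₂ : Fin t₂ ≃ A₂.Transition)
    (f : Edges G A₁ A₂) : ℕ × ℕ := (e.symm (graphEdge f), position d₁ d₂ (transitionOf f))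

theorem nodeCode_injective : Function.Injective (nodeCode v q₁ q₂) := by
  intro x y h
  have h₁ := v.symm.injective (Fin.ext (Prod.ext_iff.mp h).1)
  have h₂ := position_injective _ _ (Prod.ext_iff.mp h).2
  obtain ⟨a, b⟩ | ⟨a, b⟩ := x <;> obtain ⟨a', b'⟩ | ⟨a', b'⟩ := y <;>
    simp_all [graphNode, stateOf]

theorem edgeCode_injective : Function.Injective (edgeCode (G := G) e d₁ d₂) := by
  intro x y h
  have h₁ := e.symm.injective (Fin.ext (Prod.ext_iff.mp h).1)
  have h₂ := position_injective _ _ (Prod.ext_iff.mp h).2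
  obtain ⟨⟨a, b⟩, _⟩ | ⟨⟨a, b⟩, _⟩ := x <;> obtain ⟨⟨a', b'⟩, _⟩ | ⟨⟨a', b'⟩, _⟩ := y <;>
    simp_all [graphEdge, transitionOf]

theorem exists_nodeCode_eq {a b : ℕ} (ha : a < n) (hb : b < k₁ + k₂) :
    ∃ x, nodeCode v q₁ q₂ x = (a, b) := by
  obtain ⟨s | s, hs⟩ := exists_position_eq q₁ q₂ hb
  · exact ⟨.inl (v ⟨a, ha⟩, s), by simp [nodeCode, graphNode, stateOf, hs]⟩
  · exact ⟨.inr (v ⟨a, ha⟩, s), by simp [nodeCode, graphNode, stateOf, hs]⟩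

/-- The graph database and the automata are stored one after the other. -/
structure Stored (G : GraphDB N E L) (A₁ : NFA L Q₁) (A₂ : NFA L Q₂) (ℓ : L ↪ ℕ) (v : Fin n ≃ N)
    (e : Fin m ≃ E) (q₁ : Fin k₁ ≃ Q₁) (d₁ : Fin t₁ ≃ A₁.Transition) (q₂ : Fin k₂ ≃ Q₂)
    (d₂ : Fin t₂ ≃ A₂.Transition) (M : ℕ → ℕ) : Prop where
  graph : G.Stored ℓ v e M 0
  fst : A₁.Stored ℓ q₁ d₁ M (2 + n + 4 * m)
  snd : A₂.Stored ℓ q₂ d₂ M (2 + n + 4 * m + (2 + 2 * k₁ + 3 * t₁))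

namespace Stored

variable (h : Stored G A₁ A₂ ℓ v e q₁ d₁ q₂ d₂ M)
include h

theorem eval_base₁ : base₁.eval l M ρ = 2 + n + 4 * m := by
  have e₁ := h.graph.nodes
  have e₂ := h.graph.edges
  rw [zero_add] at e₂
  simp only [base₁, eval, PMRPair.eval_triple, e₁, e₂]
  ring

theorem eval_states₁ : (cell base₁).eval l M ρ = k₁ := by
  rw [eval, h.eval_base₁]; exact h.fst.states

theorem eval_transitions₁ : (cell (add base₁ (const 1))).eval l M ρ = t₁ := by
  simp only [eval, h.eval_base₁]; exact h.fst.transitions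

theorem eval_trans₁ : trans₁.eval l M ρ = 2 + n + 4 * m + 2 + 2 * k₁ := by
  rw [trans₁, eval, eval, eval, eval, h.eval_states₁, h.eval_base₁]; ring

theorem eval_base₂ : base₂.eval l M ρ = 2 + n + 4 * m + (2 + 2 * k₁ + 3 * t₁) := by
  rw [base₂, eval, PMRPair.eval_triple, h.eval_transitions₁, h.eval_trans₁]; ring

theorem eval_states₂ : (cell base₂).eval l M ρ = k₂ := by
  rw [eval, h.eval_base₂]; exact h.snd.states

theorem eval_transitions₂ : (cell (add base₂ (const 1))).eval l M ρ = t₂ := by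
  simp only [eval, h.eval_base₂]; exact h.snd.transitions

theorem eval_trans₂ :
    trans₂.eval l M ρ = 2 + n + 4 * m + (2 + 2 * k₁ + 3 * t₁) + 2 + 2 * k₂ := by
  rw [trans₂, eval, eval, eval, eval, h.eval_states₂, h.eval_base₂]; ring

omit h in
theorem eval_ifLt (y c t u : Term) : (ifLt y c t u).eval l M ρ =
    if y.eval l M ρ < c.eval l M ρ then t.eval l M ρ else u.eval l M ρ := by
  simp only [ifLt, eval]
  grind

theorem eval_ifNode (x y t : Term) : (ifNode x y t).eval l M ρ =
    if x.eval l M ρ < n ∧ y.eval l M ρ < k₁ + k₂ then t.eval l M ρ else 0 := by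
  have e₁ : (cell (const 0)).eval l M ρ = n := h.graph.nodes
  simp only [ifNode, eval_ifLt, e₁, ite_and]
  -- `eval.eq_5` unfolds `add` only, so `cell base₁` and `cell base₂` keep the shape needed for
  -- rewriting.
  simp only [eval.eq_5, h.eval_states₁, h.eval_states₂]
  rfl

theorem eval_ifEdge (x y t : Term) : (ifEdge x y t).eval l M ρ =
    if x.eval l M ρ < m ∧ y.eval l M ρ < t₁ + t₂ then t.eval l M ρ else 0 := by
  have e₁ : (cell (const 1)).eval l M ρ = m := by simpa [eval] using h.graph.edges
  simp only [ifEdge, eval_ifLt, e₁, ite_and]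
  simp only [eval.eq_5, h.eval_transitions₁, h.eval_transitions₂]
  rfl

theorem eval_side (y : Term) (s : Q₁ ⊕ Q₂) (hs : position q₁ q₂ s = y.eval l M ρ) :
    (ifLt y (cell base₁) (const 0) (const 1)).eval l M ρ = s.isRight.toNat := by
  rw [eval_ifLt, h.eval_states₁, ← hs]
  obtain s | s := s
  · simp [position, eval]
  · simp [position, eval]

theorem eval_state (y : Term) (s : Q₁ ⊕ Q₂) (hs : position q₁ q₂ s = y.eval l M ρ) :
    (cell (state y)).eval l M ρ = bitOf (Sum.elim (· ∈ A₁.start) (· ∈ A₂.start) s) ∧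
    (cell (add (state y) (const 1))).eval l M ρ =
      bitOf (Sum.elim (· ∈ A₁.accept) (· ∈ A₂.accept) s) := by
  simp only [eval.eq_4, eval.eq_5, state, eval_ifLt, eval.eq_6, h.eval_base₁, h.eval_base₂, ← hs]
  simp only [eval, h.fst.states]
  obtain s | s := s
  · simp only [position, Sum.elim_inl, Fin.is_lt, if_true]
    exact ⟨h.fst.start s _ (by ring), h.fst.accept s _ (by ring)⟩
  · simp only [position, Sum.elim_inr, Nat.not_lt.mpr (Nat.le_add_right _ _), if_false,
      Nat.add_sub_cancel_left]
    exact ⟨h.snd.start s _ (by ring), h.snd.accept s _ (by ring)⟩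

theorem eval_transition (y : Term) (d : A₁.Transition ⊕ A₂.Transition)
    (hd : position d₁ d₂ d = y.eval l M ρ) :
    (cell (add (transition y) (const 1))).eval l M ρ =
      ℓ (Sum.elim (fun d => d.1.2.1) (fun d => d.1.2.1) d) ∧
    (endpoint y 0).eval l M ρ =
      position q₁ q₂ (Sum.map (fun d => d.1.1) (fun d => d.1.1) d) ∧
    (endpoint y 2).eval l M ρ =
      position q₁ q₂ (Sum.map (fun d => d.1.2.2) (fun d => d.1.2.2) d) := by
  have ht : (transition y).eval l M ρ =
      if y.eval l M ρ < t₁ then 2 + n + 4 * m + 2 + 2 * k₁ + 3 * y.eval l M ρ else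
        2 + n + 4 * m + (2 + 2 * k₁ + 3 * t₁) + 2 + 2 * k₂ + 3 * (y.eval l M ρ - t₁) := by
    rw [transition, eval_ifLt, h.eval_transitions₁, eval, eval, PMRPair.eval_triple,
      PMRPair.eval_triple, eval, h.eval_transitions₁, h.eval_trans₁, h.eval_trans₂]
  simp only [endpoint, eval.eq_5, eval_ifLt, h.eval_transitions₁, h.eval_states₁]
  simp only [eval.eq_4, eval.eq_5, ht, eval.eq_1, ← hd]
  obtain d | d := d
  · simp only [position, Sum.elim_inl, Fin.is_lt, if_true, Sum.map_inl]
    exact ⟨h.fst.lab d _ (by ring), (zero_add _).trans (h.fst.src d _ (by ring)),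
      (zero_add _).trans (h.fst.tgt d _ (by ring))⟩
  · simp only [position, Sum.elim_inr, Nat.not_lt.mpr (Nat.le_add_right _ _), if_false,
      Nat.add_sub_cancel_left, Sum.map_inr]
    exact ⟨h.snd.lab d _ (by ring), congrArg _ (h.snd.src d _ (by ring)),
      congrArg _ (h.snd.tgt d _ (by ring))⟩

theorem eval_edge (x : Term) (f : E) (hf : (e.symm f : ℕ) = x.eval l M ρ) :
    (cell (add (edge x) (const 1))).eval l M ρ = v.symm (G.η f).1 ∧
    (cell (add (edge x) (const 2))).eval l M ρ = v.symm (G.η f).2 ∧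
    (cell (add (edge x) (const 3))).eval l M ρ = ℓ (G.lab f) := by
  have e₁ := h.graph.nodes
  simp only [edge, eval, PMRPair.eval_triple, e₁, ← hf]
  exact ⟨h.graph.src f _ (by ring), h.graph.tgt f _ (by ring), h.graph.lab f _ (by ring)⟩

/-- Product edges are recognised on the fly: a graph edge and a transition form one if and only if
their label identifiers agree, as `ℓ` is injective. -/
theorem eval_access_edge (x y : Term) : (access.edge x y).eval l M ρ ≠ 0 ↔
    ∃ f : Edges G A₁ A₂, edgeCode e d₁ d₂ f = (x.eval l M ρ, y.eval l M ρ) := by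
  rw [access, h.eval_ifEdge, eval_ifEq]
  constructor
  · intro hne
    rw [ite_ne_right_iff] at hne
    obtain ⟨⟨hx, hy⟩, hne⟩ := hne
    rw [ite_ne_right_iff] at hne
    have hlab := hne.1
    obtain ⟨d, hd⟩ := exists_position_eq d₁ d₂ hy
    have hf : (e.symm (e ⟨_, hx⟩) : ℕ) = x.eval l M ρ := by simp
    rw [(h.eval_transition y d hd).1, (h.eval_edge x _ hf).2.2] at hlab
    obtain d | d := d
    · exact ⟨.inl ⟨(e ⟨_, hx⟩, d), ℓ.injective hlab⟩, Prod.ext hf hd⟩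
    · exact ⟨.inr ⟨(e ⟨_, hx⟩, d), ℓ.injective hlab⟩, Prod.ext hf hd⟩
  · rintro ⟨f, hf⟩
    obtain ⟨hx, hy⟩ := Prod.ext_iff.mp hf
    simp only [edgeCode] at hx hy
    rw [if_pos ⟨hx ▸ Fin.is_lt _, hy ▸ position_lt _ _ _⟩, (h.eval_transition y _ hy).1,
      (h.eval_edge x _ hx).2.2, if_pos]
    · simp [eval]
    · obtain f | f := f
      · exact congrArg ℓ f.2
      · exact congrArg ℓ f.2

end Stored

/-- The net that is formed by the two products, in which the graph nodes and the graph edges are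
identified by their positions. -/
def net (G : GraphDB N E L) (A₁ : NFA L Q₁) (A₂ : NFA L Q₂) (v : Fin n ≃ N) (e : Fin m ≃ E) :
    Net ((N × Q₁) ⊕ (N × Q₂)) (Edges G A₁ A₂) :=
  (G.prod A₁).net (G.prod A₂) (v.symm.toEmbedding.trans Fin.valEmbedding)
    (e.symm.toEmbedding.trans Fin.valEmbedding)

theorem net_source (x : (N × Q₁) ⊕ (N × Q₂)) : x ∈ (net G A₁ A₂ v e).S ↔
    Sum.elim (· ∈ A₁.start) (· ∈ A₂.start) (stateOf x) := by
  obtain x | x := x <;> rfl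

theorem net_target (x : (N × Q₁) ⊕ (N × Q₂)) : x ∈ (net G A₁ A₂ v e).T ↔
    Sum.elim (· ∈ A₁.accept) (· ∈ A₂.accept) (stateOf x) := by
  obtain x | x := x <;> rfl

theorem represents (w : List ℕ)
    (hw : w = G.encode ν ε ℓ v e ++ A₁.encode ℓ q₁ d₁ ++ A₂.encode ℓ q₂ d₂) :
    access.Represents (net G A₁ A₂ v e) w (nodeCode v q₁ q₂) (edgeCode e d₁ d₂) := by
  have hl : w.length = 2 + n + 4 * m + (2 + 2 * k₁ + 3 * t₁) + (2 + 2 * k₂ + 3 * t₂) := by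
    rw [hw, List.length_append, List.length_append, GraphDB.length_encode, NFA.length_encode,
      NFA.length_encode]
  have st : ∀ M : ℕ → ℕ, (∀ i < w.length, M i = w.getD i 0) →
      Stored G A₁ A₂ ℓ v e q₁ d₁ q₂ d₂ M := by
    intro M hM
    have h : StoredAt M 0 w := fun i hi => by rw [zero_add, hM i hi]
    rw [hw] at h
    have h₁ := h.left.right
    have h₂ := h.right
    rw [GraphDB.length_encode, zero_add] at h₁
    rw [List.length_append, GraphDB.length_encode, NFA.length_encode, zero_add] at h₂
    exact ⟨h.left.left.graphDB, h₁.nfa, h₂.nfa⟩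
  -- Serves for source and target nodes alike: every pair of positions within range codes a node,
  -- and membership depends on its state only.
  have node : ∀ (P : Q₁ ⊕ Q₂ → Prop) (S : Set ((N × Q₁) ⊕ (N × Q₂))) (t : ℕ),
      (∀ x, x ∈ S ↔ P (stateOf x)) → ∀ a b, (∀ s, position q₁ q₂ s = b → t = bitOf (P s)) →
      ((if a < n ∧ b < k₁ + k₂ then t else 0) ≠ 0 ↔ ∃ x ∈ S, nodeCode v q₁ q₂ x = (a, b)) := by
    intro P S t hS a b ht
    constructor
    · intro hne
      rw [ite_ne_right_iff] at hne
      obtain ⟨⟨ha, hb⟩, hne⟩ := hne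
      obtain ⟨x, hx⟩ := exists_nodeCode_eq (v := v) (q₁ := q₁) (q₂ := q₂) ha hb
      rw [ht _ (Prod.ext_iff.mp hx).2, bitOf_ne_zero, ← hS] at hne
      exact ⟨x, hne, hx⟩
    · rintro ⟨x, hS', hx⟩
      obtain ⟨ha, hb⟩ := Prod.ext_iff.mp hx
      simp only [nodeCode] at ha hb
      rw [if_pos ⟨ha ▸ Fin.is_lt _, hb ▸ position_lt _ _ _⟩, ht _ hb, bitOf_ne_zero, ← hS]
      exact hS'
  constructor
  · intro x
    have h₁ := (v.symm (graphNode x)).is_lt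
    have h₂ := position_lt q₁ q₂ (stateOf x)
    simp only [nodeCode]
    omega
  · intro f
    have h₁ := (e.symm (graphEdge f)).is_lt
    have h₂ := position_lt d₁ d₂ (transitionOf f)
    simp only [edgeCode]
    omega
  · exact nodeCode_injective
  · exact edgeCode_injective
  · intro M hM ρ x y
    rw [access, (st M hM).eval_ifNode]
    exact node _ _ _ net_source _ _ fun s hs => ((st M hM).eval_state y s hs).1
  · intro M hM ρ x y
    rw [access, (st M hM).eval_ifNode]
    exact node _ _ _ net_target _ _ fun s hs => ((st M hM).eval_state y s hs).2
  · intro M hM ρ x y u hu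
    refine (Prod.ext_iff.mp hu).1.symm.trans ?_
    obtain u | u := u <;> rfl
  · intro M hM ρ x y u hu
    refine ((st M hM).eval_side y _ (Prod.ext_iff.mp hu).2).trans ?_
    obtain u | u := u <;> rfl
  · intro M hM ρ x y
    exact ((st M hM).eval_access_edge x y).mp
  · intro M hM ρ x y f hf
    obtain ⟨h₁, h₂, h₃⟩ := (st M hM).eval_transition y _ (Prod.ext_iff.mp hf).2
    obtain ⟨h₄, h₅, -⟩ := (st M hM).eval_edge x _ (Prod.ext_iff.mp hf).1
    refine ⟨((st M hM).eval_access_edge x y).mpr ⟨f, hf⟩, ?_, h₄.trans ?_, h₂.trans ?_,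
      h₅.trans ?_, h₃.trans ?_⟩
    · refine (Prod.ext_iff.mp hf).1.symm.trans ?_
      obtain f | f := f <;> rfl
    all_goals obtain f | f := f <;> rfl

end ProductPair

end RAM

/-- Set equivalence of `trim (G × A₁)` and `trim (G × A₂)`, for unambiguous automata `A₁` and `A₂`,
can be tested in polynomial time, both when the input consists of the two PMRs and when the input
consists of the graph database and the two automata. -/
theorem mainTheorem9 :
    (∃ (c : RAM.Prog) (p : Polynomial ℕ),
      ∀ (N E L Q₁ Q₂ : Type) [Finite N] [Finite E] [Finite Q₁] [Finite Q₂]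
        (G : GraphDB N E L) (A₁ : NFA L Q₁) (A₂ : NFA L Q₂)
        [Finite A₁.Transition] [Finite A₂.Transition],
        A₁.Unambiguous → A₂.Unambiguous →
        ∀ (ν : N ↪ ℕ) (ε : E ↪ ℕ) (n₁ m₁ n₂ m₂ : ℕ)
          (v₁ : Fin n₁ ≃ {v // (G.prod A₁).UsefulNode v})
          (e₁ : Fin m₁ ≃ {e // (G.prod A₁).UsefulEdge e})
          (v₂ : Fin n₂ ≃ {v // (G.prod A₂).UsefulNode v})
          (e₂ : Fin m₂ ≃ {e // (G.prod A₂).UsefulEdge e})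
          (w : List ℕ),
          w = (G.prod A₁).trim.encode ν ε v₁ e₁ ++ (G.prod A₂).trim.encode ν ε v₂ e₂ →
          c.TestsWithin w ((G.prod A₁).trim.spaths = (G.prod A₂).trim.spaths)
            (p.eval w.length)) ∧
    (∃ (c : RAM.Prog) (p : Polynomial ℕ),
      ∀ (N E L Q₁ Q₂ : Type) [Finite N] [Finite E] [Finite Q₁] [Finite Q₂]
        (G : GraphDB N E L) (A₁ : NFA L Q₁) (A₂ : NFA L Q₂)
        [Finite A₁.Transition] [Finite A₂.Transition],
        A₁.Unambiguous → A₂.Unambiguous →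
        ∀ (ν : N ↪ ℕ) (ε : E ↪ ℕ) (ℓ : L ↪ ℕ) (n m k₁ t₁ k₂ t₂ : ℕ)
          (v : Fin n ≃ N) (e : Fin m ≃ E)
          (q₁ : Fin k₁ ≃ Q₁) (d₁ : Fin t₁ ≃ A₁.Transition)
          (q₂ : Fin k₂ ≃ Q₂) (d₂ : Fin t₂ ≃ A₂.Transition)
          (w : List ℕ),
          w = G.encode ν ε ℓ v e ++ A₁.encode ℓ q₁ d₁ ++ A₂.encode ℓ q₂ d₂ →
          c.TestsWithin w ((G.prod A₁).trim.spaths = (G.prod A₂).trim.spaths)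
            (p.eval w.length)) := by
  refine ⟨⟨RAM.PMRPair.access.program, RAM.PMRPair.access.time, ?_⟩,
    ⟨RAM.ProductPair.access.program, RAM.ProductPair.access.time, ?_⟩⟩
  · intro N E L Q₁ Q₂ _ _ _ _ G A₁ A₂ _ _ h₁ h₂ ν ε n₁ m₁ n₂ m₂ v₁ e₁ v₂ e₂ w hw
    have := Fintype.ofEquiv _ v₁
    have := Fintype.ofEquiv _ e₁
    have := Fintype.ofEquiv _ v₂
    have := Fintype.ofEquiv _ e₂
    exact (RAM.PMRPair.represents w hw).program_testsWithin
      (PMR.spaths_eq_iff (GraphDB.unambiguous_prod h₁).trim (GraphDB.unambiguous_prod h₂).trim ν ε)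
  · intro N E L Q₁ Q₂ _ _ _ _ G A₁ A₂ _ _ h₁ h₂ ν ε ℓ n m k₁ t₁ k₂ t₂ v e q₁ d₁ q₂ d₂ w hw
    have := Fintype.ofFinite (N × Q₁)
    have := Fintype.ofFinite (N × Q₂)
    have := Fintype.ofFinite {p : E × A₁.Transition // p.2.1.2.1 = G.lab p.1}
    have := Fintype.ofFinite {p : E × A₂.Transition // p.2.1.2.1 = G.lab p.1}
    -- Trimming leaves the represented sets unchanged, so the untrimmed products, which are
    -- unambiguous too, can be compared. Any injective identifiers will do, and the net uses
    -- positions.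
    rw [PMR.spaths_trim, PMR.spaths_trim]
    exact (RAM.ProductPair.represents w hw).program_testsWithin
      (PMR.spaths_eq_iff (GraphDB.unambiguous_prod h₁) (GraphDB.unambiguous_prod h₂) _ _)
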